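/- Let $n\ge 1$, $\theta\in(0,\pi)$ and let $k\ge 2$ be an integer. Let $\mathbb S^{n+1}\subset\mathbb R^{n+1}\times\mathbb R$ be the round unit sphere and let $\mathcal S_\theta=\{(\sin\theta\,p,\cos\theta):p\in\mathbb S^n\}$ be the geodesic sphere of radius $\theta$ about the pole $(0,1)$ (that is, $q_{n+1}=\theta$ in polar coordinates). For $u:\mathbb S^n\to\mathbb R$ let $$X_u(p)=\gamma(p,u(p)),\qquad \gamma(p,s)=\big(\sin(\theta+s)\,p,\ \cos(\theta+s)\big),$$ be the normal geodesic graph of $u$ over $\mathcal S_\theta=X_0(\mathbb S^n)$. Let $\nu(u)$ be its outer unit normal in $\mathbb S^{n+1}$ (so $\langle\dot\gamma,\nu(u)\rangle>0$, the dot being $\partial_s$), $\kappa(u)=(\kappa_1,\dots,\kappa_n)$ its principal curvatures (the eigenvalues of the Weingarten map $g^{-1}h$ with $h(v,w)=\langle\bar\nabla_v\nu,dX_u w\rangle$), $d\mu_u$ its induced volume form and $L(u)=\langle\dot\gamma|_{s=u},\nu(u)\rangle^{-1}$. Let $F:\mathbb R^n\to\mathbb R$ be smooth and symmetric. Let $\hat\Xi$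 be a weight function, that is, a map $u\mapsto\hat\Xi(X_u)$ from $C^k(\mathbb S^n)$ to $C^0(\mathbb S^n)$, which is continuous at $u=0$ and for which $\hat\Xi(X_0)$ is a nonzero constant. Put $$G(u)=L(u)\left(\frac{\int_{\mathbb S^n}F(\kappa(u))\,\hat\Xi(X_u)\,d\mu_u}{\int_{\mathbb S^n}\hat\Xi(X_u)\,d\mu_u}-F(\kappa(u))\right).$$ Then all the principal curvatures of $\mathcal S_\theta$ equal $\cot\theta$; write $\mathring\kappa=(\cot\theta,\dots,\cot\theta)$. For $u$ in a neighbourhood of $0$ in $C^k(\mathbb S^n)$ both integrands are integrable, the denominator is nonzero and $G(u)\in C^0(\mathbb S^n)$. The map $G$ into $C^0(\mathbb S^n)$ is Fréchet differentiable at $0\in C^k(\mathbb S^n)$, and for all $w\in C^k(\mathbb S^n)$ $$DG(0)[w]=\frac{\partial F}{\partial\kappa_1}(\mathring\kappa)\,\sin^{-2}\theta\,\left(\Delta_{\mathbb S^n}w+nw-n\,\frac{1}{\mu_0(\mathbb S^n)}\int_{\mathbb S^n}w\,d\mu_0\right),$$ where $\Delta_{\mathbb S^n}$ is the Laplace–Beltrami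 operator of the round unit sphere $\mathbb S^n$. -/

import Mathlib

open scoped Manifold ContDiff RealInnerProductSpace
open MeasureTheory Filter Topology

noncomputable section

namespace SphereFlow

/-- The coordinate space `ℝᵐ` with its Euclidean norm. -/
abbrev Euc (m : ℕ) := EuclideanSpace ℝ (Fin m)

/-- The round unit sphere `𝕊ⁿ ⊂ ℝⁿ⁺¹`. -/
abbrev Sph (n : ℕ) := Metric.sphere (0 : Euc (n + 1)) 1

/-- The Euclidean space `ℝⁿ⁺² = ℝⁿ⁺¹ × ℝ`; its unit sphere is the ambient manifold `𝕊ⁿ⁺¹`. -/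
abbrev Amb (n : ℕ) := WithLp 2 (Euc (n + 1) × ℝ)

/-! ### Differentiation along `𝕊ⁿ` -/

section Calculus

variable {n : ℕ} {V : Type*} [NormedAddCommGroup V] [NormedSpace ℝ V]

/-- The extension of a function on `𝕊ⁿ` to `ℝⁿ⁺¹ ∖ {0}` that is constant along rays. -/
def radialExt (f : Sph n → V) (x : Euc (n + 1)) : V :=
  if hx : x ≠ 0 then
    f ⟨‖x‖⁻¹ • x, by
      rw [mem_sphere_zero_iff_norm, norm_smul, norm_inv, norm_norm,
        inv_mul_cancel₀ (norm_ne_zero_iff.2 hx)]⟩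
  else 0

/-- The tangent space `T_p 𝕊ⁿ = p^⊥`, with the inner product of `ℝⁿ⁺¹`. -/
abbrev Tan (p : Sph n) : Submodule ℝ (Euc (n + 1)) := (ℝ ∙ (p : Euc (n + 1)))ᗮ

/-- The differential at `p` of a vector-valued function on `𝕊ⁿ`. -/
def sphDeriv (f : Sph n → V) (p : Sph n) : Tan p →L[ℝ] V :=
  (fderiv ℝ (radialExt f) p).comp (Tan p).subtypeL

/-- The gradient on the round sphere `𝕊ⁿ`. -/
def sphGrad (w : Sph n → ℝ) (p : Sph n) : Tan p :=
  (InnerProductSpace.toDual ℝ (Tan p)).symm (sphDeriv w p)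

/-- The Laplace-Beltrami operator of the round sphere `𝕊ⁿ`: the divergence of the gradient, that
is, the trace of `v ↦ ∇_v (grad w)`, where the Levi-Civita connection of `𝕊ⁿ` is the tangential
part of the derivative in `ℝⁿ⁺¹`. -/
def sphLaplacian (w : Sph n → ℝ) (p : Sph n) : ℝ :=
  LinearMap.trace ℝ (Tan p)
    (((Tan p).orthogonalProjectionOnto.comp
      (sphDeriv (fun q => (sphGrad w q : Euc (n + 1))) p) : Tan p →L[ℝ] Tan p) :
        Tan p →ₗ[ℝ] Tan p)

end Calculus

/-! ### The Banach space `C^k(𝕊ⁿ)` -/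

/-- `C^k` functions on `𝕊ⁿ`. -/
abbrev CkSph (n k : ℕ) := C^(k : ℕ∞ω)⟮𝓡 n, Sph n; 𝓘(ℝ, ℝ), ℝ⟯

theorem radialExt_coe {n : ℕ} (u : Sph n → ℝ) (p : Sph n) :
    radialExt u (p : Euc (n + 1)) = u p := by
  have hp : ‖(p : Euc (n + 1))‖ = 1 := by simp
  have h0 : (p : Euc (n + 1)) ≠ 0 := by
    rw [← norm_ne_zero_iff, hp]; exact one_ne_zero
  unfold radialExt
  rw [dif_pos h0]
  congr 1
  ext1
  simp [hp]

theorem contDiffAt_radialExt {n k : ℕ} (u : CkSph n k) {x : Euc (n + 1)} (hx : x ≠ 0) :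
    ContDiffAt ℝ k (radialExt (u : Sph n → ℝ)) x := by
  have : Fact (Module.finrank ℝ (Euc (n + 1)) = n + 1) := ⟨finrank_euclideanSpace_fin⟩
  let U : TopologicalSpace.Opens (Euc (n + 1)) := ⟨{0}ᶜ, isOpen_compl_singleton⟩
  have hU : ∀ y : U, (y : Euc (n + 1)) ≠ 0 := fun y => y.2
  have hf : ContMDiff 𝓘(ℝ, Euc (n + 1)) 𝓘(ℝ, Euc (n + 1)) (k : ℕ∞ω)
      (fun y : U => ‖(y : Euc (n + 1))‖⁻¹ • (y : Euc (n + 1))) := by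
    intro y
    have : ContDiffAt ℝ (k : ℕ∞ω) (fun z : Euc (n + 1) => ‖z‖⁻¹ • z) (y : Euc (n + 1)) :=
      ((contDiffAt_norm ℝ (hU y)).inv (norm_ne_zero_iff.2 (hU y))).smul contDiffAt_id
    exact contMDiffAt_subtype_iff.2 this.contMDiffAt
  have hs : ∀ y : U, ‖(y : Euc (n + 1))‖⁻¹ • (y : Euc (n + 1)) ∈
      Metric.sphere (0 : Euc (n + 1)) 1 := fun y => by
    rw [mem_sphere_zero_iff_norm, norm_smul, norm_inv, norm_norm,
      inv_mul_cancel₀ (norm_ne_zero_iff.2 (hU y))]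
  have hg := u.contMDiff.comp (ContMDiff.codRestrict_sphere (n := n) hf hs)
  have hx' := hg (⟨x, hx⟩ : U)
  have he : ((u : Sph n → ℝ) ∘ Set.codRestrict
      (fun y : U => ‖(y : Euc (n + 1))‖⁻¹ • (y : Euc (n + 1))) _ hs)
      = fun y : U => radialExt (u : Sph n → ℝ) (y : Euc (n + 1)) := by
    funext y
    unfold radialExt
    rw [dif_pos (hU y)]
    rfl
  rw [he] at hx'
  exact (contMDiffAt_subtype_iff.1 hx').contDiffAt

set_option synthInstance.maxHeartbeats 400000 in
/-- The derivatives up to order `k` of (the radial extension of) a `C^k` function, restricted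
to `𝕊ⁿ`. -/
def jet (n k : ℕ) : CkSph n k →ₗ[ℝ]
    ((j : Fin (k + 1)) → C(Sph n, Euc (n + 1) [×(j : ℕ)]→L[ℝ] ℝ)) where
  toFun u j :=
    { toFun := fun p => iteratedFDeriv ℝ j (radialExt (u : Sph n → ℝ)) (p : Euc (n + 1))
      continuous_toFun := by
        refine continuous_iff_continuousAt.2 fun p => ?_
        have h0 : (p : Euc (n + 1)) ≠ 0 := ne_zero_of_mem_unit_sphere p
        have h := (contDiffAt_radialExt u h0).of_le
          (m := ((j : ℕ) : ℕ∞ω)) (by exact_mod_cast Nat.le_of_lt_succ j.2)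
        exact ((h.iteratedFDeriv_right (m := 0) (i := (j : ℕ))
          (by simp)).continuousAt).comp continuous_subtype_val.continuousAt }
  map_add' u v := by
    funext j
    ext1 p
    have h0 : (p : Euc (n + 1)) ≠ 0 := ne_zero_of_mem_unit_sphere p
    have hj : ((j : ℕ) : ℕ∞ω) ≤ (k : ℕ∞ω) := by exact_mod_cast Nat.le_of_lt_succ j.2
    have he : radialExt ((u + v : CkSph n k) : Sph n → ℝ)
        = radialExt (u : Sph n → ℝ) + radialExt (v : Sph n → ℝ) := by
      funext x
      by_cases hx : x ≠ 0 <;> simp [radialExt, hx]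
    change iteratedFDeriv ℝ j (radialExt ((u + v : CkSph n k) : Sph n → ℝ)) _ = _ + _
    rw [he]
    exact iteratedFDeriv_add_apply ((contDiffAt_radialExt u h0).of_le hj)
      ((contDiffAt_radialExt v h0).of_le hj)
  map_smul' c u := by
    funext j
    ext1 p
    have h0 : (p : Euc (n + 1)) ≠ 0 := ne_zero_of_mem_unit_sphere p
    have hj : ((j : ℕ) : ℕ∞ω) ≤ (k : ℕ∞ω) := by exact_mod_cast Nat.le_of_lt_succ j.2
    have he : radialExt ((c • u : CkSph n k) : Sph n → ℝ)
        = c • radialExt (u : Sph n → ℝ) := by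
      funext x
      by_cases hx : x ≠ 0 <;> simp [radialExt, hx]
    change iteratedFDeriv ℝ j (radialExt ((c • u : CkSph n k) : Sph n → ℝ)) _ = c • _
    rw [he]
    exact iteratedFDeriv_const_smul_apply ((contDiffAt_radialExt u h0).of_le hj)

set_option synthInstance.maxHeartbeats 400000 in
theorem jet_injective (n k : ℕ) : Function.Injective (jet n k) := by
  intro u v h
  ext p
  have h1 := DFunLike.congr_fun (congrFun h 0) p
  have h2 : iteratedFDeriv ℝ 0 (radialExt (u : Sph n → ℝ)) (p : Euc (n + 1)) 0
      = iteratedFDeriv ℝ 0 (radialExt (v : Sph n → ℝ)) (p : Euc (n + 1)) 0 :=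
    congrArg (fun m : Euc (n + 1) [×0]→L[ℝ] ℝ => m 0) h1
  simpa only [iteratedFDeriv_zero_apply, radialExt_coe] using h2

set_option synthInstance.maxHeartbeats 400000 in
/-- The `C^k` norm: the maximum over `j ≤ k` of the supremum over `𝕊ⁿ` of the `j`-th derivative. -/
instance instNormedAddCommGroupCkSph (n k : ℕ) : NormedAddCommGroup (CkSph n k) :=
  NormedAddCommGroup.induced (CkSph n k) _ (jet n k) (jet_injective n k)

set_option synthInstance.maxHeartbeats 400000 in
instance instNormedSpaceCkSph (n k : ℕ) : NormedSpace ℝ (CkSph n k) :=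
  NormedSpace.induced ℝ (CkSph n k) _ (jet n k)

/-! ### Normal graphs over the geodesic sphere of radius `θ` in `𝕊ⁿ⁺¹` -/

section Graph

variable {n : ℕ} (θ : ℝ) (u : Sph n → ℝ) (p : Sph n)

/-- `γ(p, s)`: the unit speed geodesic of `𝕊ⁿ⁺¹` that leaves the sphere `{q_{n+1} = θ}` at the
point with coordinates `(p, θ)` in the outer normal direction, that is, in the direction of
increasing `q_{n+1}` (the distance to the pole `(0, 1)`). -/
def geod (s : ℝ) : Amb n :=
  WithLp.toLp 2 (Real.sin (θ + s) • (p : Euc (n + 1)), Real.cos (θ + s))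

/-- The normal graph `X_u(p) = γ(p, u(p))`. -/
def graph : Amb n := geod θ p (u p)

/-- The velocity `γ̇(p, s)` at `s = u(p)`. -/
def geodVel : Amb n := deriv (geod θ p) (u p)

/-- The differential of `X_u` at `p`. -/
def graphDeriv : Tan p →L[ℝ] Amb n := sphDeriv (graph θ u) p

/-- The outer unit normal `ν(u)` in `𝕊ⁿ⁺¹`: the normalised component of `γ̇` orthogonal to the
position vector `X_u(p)` and to the tangent space of the graph. -/
def normal : Amb n :=
  let N := ((ℝ ∙ graph θ u p) ⊔ (graphDeriv θ u p).range)ᗮ.starProjection (geodVel θ u p)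
  ‖N‖⁻¹ • N

/-- The covariant derivative `v ↦ ∇̄_v ν` of the unit normal along the graph, where the
Levi-Civita connection of `𝕊ⁿ⁺¹` is the part of the derivative in `ℝⁿ⁺²` tangent to `𝕊ⁿ⁺¹`. -/
def normalCovDeriv : Tan p →L[ℝ] Amb n :=
  (ℝ ∙ graph θ u p)ᗮ.starProjection.comp (sphDeriv (normal θ u) p)

/-- The induced metric: `⟪inducedMetric θ u p v, w⟫ = g(v, w) = ⟪dX_u v, dX_u w⟫`. -/
def inducedMetric : Tan p →L[ℝ] Tan p :=
  (ContinuousLinearMap.adjoint (graphDeriv θ u p)).comp (graphDeriv θ u p)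

/-- The second fundamental form:
`⟪secondFundamentalForm θ u p v, w⟫ = h(v, w) = ⟪∇̄_v ν, dX_u w⟫`. -/
def secondFundamentalForm : Tan p →L[ℝ] Tan p :=
  (ContinuousLinearMap.adjoint (graphDeriv θ u p)).comp (normalCovDeriv θ u p)

/-- The Weingarten map `𝒲 = g⁻¹ h`. -/
def weingarten : Tan p →L[ℝ] Tan p :=
  Ring.inverse (inducedMetric θ u p) * secondFundamentalForm θ u p

/-- The principal curvatures `κ₁ ≤ … ≤ κₙ`: the eigenvalues of the Weingarten map, repeated
according to multiplicity. -/
def principalCurvatures : Fin n → ℝ := fun i =>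
  ((weingarten θ u p : Tan p →ₗ[ℝ] Tan p).charpoly.roots.sort (· ≤ ·)).getD i 0

/-- The standard surface measure of `𝕊ⁿ`. -/
def surfaceMeasure (n : ℕ) : Measure (Sph n) := (volume : Measure (Euc (n + 1))).toSphere

/-- The volume form `dμ_u` of the induced metric, as a measure on `𝕊ⁿ`. -/
def graphMeasure : Measure (Sph n) :=
  (surfaceMeasure n).withDensity fun q =>
    ENNReal.ofReal (Real.sqrt (LinearMap.det (inducedMetric θ u q : Tan q →ₗ[ℝ] Tan q)))

/-- `L(u) = ⟪γ̇, ν(u)⟫⁻¹`. -/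
def tilt : ℝ := (⟪geodVel θ u p, normal θ u p⟫)⁻¹

/-- The speed `Ĝ(X_u) = ∫ F(κ) Ξ dμ_u / ∫ Ξ dμ_u - F(κ)`, where `Ξ` is the weight on the graph. -/
def speedHat (F : (Fin n → ℝ) → ℝ) (Ξ : Sph n → ℝ) : ℝ :=
  (∫ q, F (principalCurvatures θ u q) * Ξ q ∂graphMeasure θ u) /
      (∫ q, Ξ q ∂graphMeasure θ u)
    - F (principalCurvatures θ u p)

/-- The speed of the graph function, `G(u) = L(u) Ĝ(X_u)`. -/
def graphSpeed (F : (Fin n → ℝ) → ℝ) (Ξ : Sph n → ℝ) : ℝ :=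
  tilt θ u p * speedHat θ u p F Ξ

end Graph

end SphereFlow

end

/-! Everything is expanded to first order at `u = 0`, uniformly in the base point. With ξ = grad u
and W = `slope`, the induced metric is sin²(θ+u)·1 + ξ⊗ξ, and the second fundamental form is W⁻¹(sin
cos·1 − Hess u + 2cot·ξ⊗ξ). The metric is a rank-one perturbation of a scalar, so its inverse is
explicit. Since ξ⊗ξ and W − 1 are quadratic in the `C^k` norm, the Weingarten map is cot θ·1 −
sin⁻²θ (u·1 + Hess u) + o(‖u‖) (`isLittleO_weingartenError`).

Ordered eigenvalues need not be differentiable, but this is never needed. They deviate from cot θ by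
at most the operator norm of the deviation of the Weingarten map, and the differential of a
symmetric `F` at a diagonal point is a multiple of the sum of the coordinates (`fderiv_symmetric`).
So only the trace enters, and with b = ∂₁F · sin⁻²θ one gets F(κ(u)) = F(κ̊) − b(Δu + nu) + o(‖u‖)
(`isLittleO_speedFunction`).

In the weighted mean, F(κ) − F(κ̊) is already O(‖u‖). Replacing weight times area density by its
constant limit therefore costs only o(‖u‖), and mere continuity of the weight at 0 suffices. As Δu
has integral zero (`integral_sphLaplacian`), the mean is F(κ̊) − b n ⨍u + o(‖u‖). Subtracting gives
the operator; the factor L = W = 1 + O(‖u‖²) multiplies a bracket that vanishes at 0 and contributes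
nothing.

Well-posedness of the speed rests on continuity of the principal curvatures in the base point
(`continuousAt_sortedEigs`). -/

noncomputable section

namespace SphereFlow

/-! ### Radial extensions and differentiation along the sphere -/

section RadialCalculus

variable {n : ℕ} {V : Type*}

theorem coe_ne_zero (p : Sph n) : (p : Euc (n + 1)) ≠ 0 := ne_zero_of_mem_unit_sphere p

theorem norm_coe (p : Sph n) : ‖(p : Euc (n + 1))‖ = 1 := by simp

theorem inner_coe_self (p : Sph n) : ⟪(p : Euc (n + 1)), (p : Euc (n + 1))⟫ = 1 := by
  rw [real_inner_self_eq_norm_sq, norm_coe, one_pow]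

theorem inner_tan (p : Sph n) (v : Tan p) : ⟪(p : Euc (n + 1)), (v : Euc (n + 1))⟫ = 0 :=
  Submodule.mem_orthogonal_singleton_iff_inner_right.1 v.2

theorem mem_tan_iff (p : Sph n) (v : Euc (n + 1)) :
    v ∈ Tan p ↔ ⟪(p : Euc (n + 1)), v⟫ = 0 :=
  Submodule.mem_orthogonal_singleton_iff_inner_right

/-- The radial projection of a nonzero vector to the unit sphere. -/
def toSph (x : Euc (n + 1)) (hx : x ≠ 0) : Sph n :=
  ⟨‖x‖⁻¹ • x, by
    rw [mem_sphere_zero_iff_norm, norm_smul, norm_inv, norm_norm,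
      inv_mul_cancel₀ (norm_ne_zero_iff.2 hx)]⟩

variable [NormedAddCommGroup V]

theorem radialExt_of_ne (f : Sph n → V) {x : Euc (n + 1)} (hx : x ≠ 0) :
    radialExt f x = f (toSph x hx) := by
  rw [radialExt, dif_pos hx]; rfl

theorem toSph_coe (p : Sph n) : toSph (p : Euc (n + 1)) (coe_ne_zero p) = p := by
  ext1; simp [toSph]

theorem radialExt_apply_coe (f : Sph n → V) (p : Sph n) :
    radialExt f (p : Euc (n + 1)) = f p := by
  rw [radialExt_of_ne f (coe_ne_zero p), toSph_coe]

theorem radialExt_smul (f : Sph n → V) {r : ℝ} (hr : 0 < r) (x : Euc (n + 1)) :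
    radialExt f (r • x) = radialExt f x := by
  by_cases hx : x = 0
  · simp [hx]
  · have h : r • x ≠ 0 := smul_ne_zero hr.ne' hx
    rw [radialExt_of_ne f h, radialExt_of_ne f hx]
    congr 1
    ext1
    simp only [toSph, norm_smul, Real.norm_eq_abs, abs_of_pos hr, smul_smul, mul_inv]
    congr 1
    field_simp

variable [NormedSpace ℝ V]

theorem hasFDerivAt_normalize (p : Sph n) :
    ∃ L : Euc (n + 1) →L[ℝ] Euc (n + 1),
      HasFDerivAt (fun x : Euc (n + 1) => ‖x‖⁻¹ • x) L p ∧ ∀ v : Tan p, L v = v := by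
  have hnorm : HasFDerivAt (fun x : Euc (n + 1) => ‖x‖ ^ 2)
      (2 • innerSL ℝ (p : Euc (n + 1))) (p : Euc (n + 1)) :=
    (hasStrictFDerivAt_norm_sq _).hasFDerivAt
  have hd : DifferentiableAt ℝ (fun x : Euc (n + 1) => ‖x‖⁻¹) (p : Euc (n + 1)) :=
    ((contDiffAt_norm ℝ (coe_ne_zero p)).differentiableAt one_ne_zero).inv
      (norm_ne_zero_iff.2 (coe_ne_zero p))
  refine ⟨_, hd.hasFDerivAt.smul (hasFDerivAt_id _), fun v => ?_⟩
  -- This product is 1 near `p`, and the differential 2⟪p, ·⟫ of ‖x‖² kills tangent vectors; hence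
  -- so does the differential of ‖x‖⁻¹.
  have h1 : HasFDerivAt (fun x : Euc (n + 1) => (‖x‖⁻¹) ^ 2 * ‖x‖ ^ 2) _ (p : Euc (n + 1)) :=
    (hd.hasFDerivAt.pow 2).mul hnorm
  have h2 : HasFDerivAt (fun x : Euc (n + 1) => (‖x‖⁻¹) ^ 2 * ‖x‖ ^ 2)
      (0 : Euc (n + 1) →L[ℝ] ℝ) (p : Euc (n + 1)) := by
    refine (hasFDerivAt_const (1 : ℝ) _).congr_of_eventuallyEq ?_
    filter_upwards [isOpen_compl_singleton.mem_nhds (coe_ne_zero p)] with x hx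
    have : ‖x‖ ≠ 0 := norm_ne_zero_iff.2 hx
    field_simp
  have h3 := congrArg (fun L : Euc (n + 1) →L[ℝ] ℝ => L v) (h1.unique h2)
  have h4 : fderiv ℝ (fun x : Euc (n + 1) => ‖x‖⁻¹) p v = 0 := by
    simpa [inner_tan] using h3
  simp [h4]

/-- The differential along the sphere can be computed from any extension. -/
theorem sphDeriv_eq {f : Sph n → V} {Φ : Euc (n + 1) → V} {Φ' : Euc (n + 1) →L[ℝ] V} {p : Sph n}
    (h : ∀ q : Sph n, f q = Φ q) (hΦ : HasFDerivAt Φ Φ' p) (v : Tan p) :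
    sphDeriv f p v = Φ' v := by
  obtain ⟨L, hL, hLv⟩ := hasFDerivAt_normalize p
  have hp : ‖(p : Euc (n + 1))‖⁻¹ • (p : Euc (n + 1)) = p := by simp
  have h1 : HasFDerivAt (radialExt f) (Φ'.comp L) p := by
    refine HasFDerivAt.congr_of_eventuallyEq (f := Φ ∘ fun x => ‖x‖⁻¹ • x) ?_ ?_
    · refine HasFDerivAt.comp _ ?_ hL
      rwa [hp]
    · filter_upwards [isOpen_compl_singleton.mem_nhds (coe_ne_zero p)] with x hx
      rw [radialExt_of_ne f hx, h]
      rfl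
  rw [sphDeriv, h1.fderiv]
  simp [hLv]

/-- The Euclidean gradient of the radial extension. -/
def gradExt (w : Sph n → ℝ) (x : Euc (n + 1)) : Euc (n + 1) :=
  (InnerProductSpace.toDual ℝ (Euc (n + 1))).symm (fderiv ℝ (radialExt w) x)

theorem inner_gradExt (w : Sph n → ℝ) (x v : Euc (n + 1)) :
    ⟪gradExt w x, v⟫ = fderiv ℝ (radialExt w) x v := by
  rw [gradExt, InnerProductSpace.toDual_symm_apply]

/-- Functions on the sphere of class `C²`. -/
def IsC2 (w : Sph n → ℝ) : Prop := ∀ x : Euc (n + 1), x ≠ 0 → ContDiffAt ℝ 2 (radialExt w) x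


/-- The second derivative of the radial extension. -/
def hessExt (w : Sph n → ℝ) (x : Euc (n + 1)) : Euc (n + 1) →L[ℝ] Euc (n + 1) →L[ℝ] ℝ :=
  fderiv ℝ (fderiv ℝ (radialExt w)) x

namespace IsC2

variable {w : Sph n → ℝ} {x : Euc (n + 1)}

theorem differentiableAt (hw : IsC2 w) (hx : x ≠ 0) : DifferentiableAt ℝ (radialExt w) x :=
  (hw x hx).differentiableAt two_ne_zero

theorem contDiffAt_fderiv (hw : IsC2 w) (hx : x ≠ 0) :
    ContDiffAt ℝ 1 (fderiv ℝ (radialExt w)) x :=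
  (hw x hx).fderiv_right (by norm_num)

theorem hasFDerivAt_fderiv (hw : IsC2 w) (hx : x ≠ 0) :
    HasFDerivAt (fderiv ℝ (radialExt w)) (hessExt w x) x :=
  ((hw.contDiffAt_fderiv hx).differentiableAt one_ne_zero).hasFDerivAt

theorem continuousAt_hessExt (hw : IsC2 w) (hx : x ≠ 0) : ContinuousAt (hessExt w) x :=
  ((hw.contDiffAt_fderiv hx).fderiv_right (m := 0) (by norm_num)).continuousAt

/-- Euler's relation for a function homogeneous of degree 0. -/
theorem fderiv_self (hw : IsC2 w) (hx : x ≠ 0) : fderiv ℝ (radialExt w) x x = 0 := by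
  have h1 : HasDerivAt (fun r : ℝ => radialExt w (r • x)) (fderiv ℝ (radialExt w) x x) 1 := by
    have hf : HasFDerivAt (radialExt w) (fderiv ℝ (radialExt w) x) ((1 : ℝ) • x) := by
      rw [one_smul]; exact (hw.differentiableAt hx).hasFDerivAt
    have := hf.comp_hasDerivAt (1 : ℝ) ((hasDerivAt_id (1 : ℝ)).smul_const x)
    rw [one_smul] at this
    exact this
  have h2 : HasDerivAt (fun r : ℝ => radialExt w (r • x)) 0 1 := by
    refine (hasDerivAt_const (1 : ℝ) (radialExt w x)).congr_of_eventuallyEq ?_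
    filter_upwards [lt_mem_nhds one_pos] with r hr
    exact radialExt_smul w hr x
  exact h1.unique h2

theorem hessExt_symm (hw : IsC2 w) (hx : x ≠ 0) (u v : Euc (n + 1)) :
    hessExt w x u v = hessExt w x v u :=
  ((hw x hx).isSymmSndFDerivAt (by simp)) u v

/-- Differentiating Euler's relation dw_y(y) = 0 in `y` along `v` gives this. -/
theorem hessExt_apply_self (hw : IsC2 w) (hx : x ≠ 0) (v : Euc (n + 1)) :
    hessExt w x v x = - fderiv ℝ (radialExt w) x v := by
  have h1 := (hw.hasFDerivAt_fderiv hx).clm_apply (hasFDerivAt_id x)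
  have h2 : HasFDerivAt (fun y => fderiv ℝ (radialExt w) y (id y))
      (0 : Euc (n + 1) →L[ℝ] ℝ) x := by
    refine (hasFDerivAt_const (0 : ℝ) x).congr_of_eventuallyEq ?_
    filter_upwards [isOpen_compl_singleton.mem_nhds hx] with y hy
    exact hw.fderiv_self hy
  have h3 := congrArg (fun L : Euc (n + 1) →L[ℝ] ℝ => L v) (h1.unique h2)
  simp at h3
  linarith

theorem hessExt_self_apply (hw : IsC2 w) (hx : x ≠ 0) (v : Euc (n + 1)) :
    hessExt w x x v = - fderiv ℝ (radialExt w) x v := by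
  rw [hw.hessExt_symm hx, hw.hessExt_apply_self hx]

theorem hasFDerivAt_gradExt (hw : IsC2 w) (hx : x ≠ 0) :
    ∃ D : Euc (n + 1) →L[ℝ] Euc (n + 1), HasFDerivAt (gradExt w) D x ∧
      ∀ v u, ⟪D v, u⟫ = hessExt w x v u := by
  refine ⟨_, ((InnerProductSpace.toDual ℝ (Euc (n + 1))).symm.toContinuousLinearEquiv
    |>.toContinuousLinearMap.hasFDerivAt).comp x (hw.hasFDerivAt_fderiv hx), fun v u => ?_⟩
  simp

theorem continuousAt_gradExt (hw : IsC2 w) (hx : x ≠ 0) : ContinuousAt (gradExt w) x := by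
  obtain ⟨D, hD, -⟩ := hw.hasFDerivAt_gradExt hx
  exact hD.continuousAt

theorem sphDeriv_apply (hw : IsC2 w) (p : Sph n) (v : Tan p) :
    sphDeriv w p v = fderiv ℝ (radialExt w) p v :=
  sphDeriv_eq (fun q => (radialExt_apply_coe w q).symm)
    (hw.differentiableAt (coe_ne_zero p)).hasFDerivAt v

theorem inner_gradExt_self (hw : IsC2 w) (p : Sph n) :
    ⟪gradExt w p, (p : Euc (n + 1))⟫ = 0 := by
  rw [inner_gradExt, hw.fderiv_self (coe_ne_zero p)]

theorem coe_sphGrad (hw : IsC2 w) (p : Sph n) : (sphGrad w p : Euc (n + 1)) = gradExt w p := by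
  have h : gradExt w p ∈ Tan p := by
    rw [mem_tan_iff, real_inner_comm, hw.inner_gradExt_self]
  have : sphGrad w p = ⟨gradExt w p, h⟩ := by
    refine ext_inner_right ℝ fun v => ?_
    rw [sphGrad, InnerProductSpace.toDual_symm_apply, hw.sphDeriv_apply, ← inner_gradExt]
    rfl
  rw [this]

theorem inner_sphGrad (hw : IsC2 w) (p : Sph n) (v : Tan p) :
    ⟪sphGrad w p, v⟫ = fderiv ℝ (radialExt w) p v := by
  rw [← inner_gradExt, ← hw.coe_sphGrad]; rfl

end IsC2

/-- The covariant Hessian of a function on the sphere, as an endomorphism of `T_p 𝕊ⁿ`. -/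
def sphHess (w : Sph n → ℝ) (p : Sph n) : Tan p →L[ℝ] Tan p :=
  (Tan p).orthogonalProjectionOnto.comp
    (sphDeriv (fun q => (sphGrad w q : Euc (n + 1))) p)

theorem sphLaplacian_eq_trace (w : Sph n → ℝ) (p : Sph n) :
    sphLaplacian w p = LinearMap.trace ℝ (Tan p) (sphHess w p : Tan p →ₗ[ℝ] Tan p) := rfl

namespace IsC2

variable {w : Sph n → ℝ}

/-- The gradient of the radial extension is already tangent, and the Levi-Civita connection is the
projected flat derivative, so the Euclidean Hessian is merely restricted. -/
theorem inner_sphHess (hw : IsC2 w) (p : Sph n) (u v : Tan p) :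
    ⟪sphHess w p u, v⟫ = hessExt w p u v := by
  obtain ⟨D, hD, hD'⟩ := hw.hasFDerivAt_gradExt (coe_ne_zero p)
  rw [sphHess, ContinuousLinearMap.comp_apply, Submodule.inner_orthogonalProjectionOnto_eq_of_mem_right,
    sphDeriv_eq (fun q => hw.coe_sphGrad q) hD, hD']

theorem sphHess_symm (hw : IsC2 w) (p : Sph n) (u v : Tan p) :
    ⟪sphHess w p u, v⟫ = ⟪u, sphHess w p v⟫ := by
  rw [real_inner_comm (sphHess w p v), hw.inner_sphHess, hw.inner_sphHess,
    hw.hessExt_symm (coe_ne_zero p)]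

theorem norm_sphHess_le (hw : IsC2 w) (p : Sph n) : ‖sphHess w p‖ ≤ ‖hessExt w p‖ := by
  refine ContinuousLinearMap.opNorm_le_bound _ (norm_nonneg (hessExt w p)) fun u => ?_
  have h : ‖sphHess w p u‖ ^ 2 ≤ ‖hessExt w p‖ * ‖u‖ * ‖sphHess w p u‖ := by
    rw [← real_inner_self_eq_norm_sq, hw.inner_sphHess]
    exact (Real.le_norm_self _).trans ((hessExt w p).le_opNorm₂ _ _)
  by_contra! hlt
  have : 0 < ‖sphHess w p u‖ := lt_of_le_of_lt (by positivity) hlt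
  nlinarith

theorem norm_sphGrad (hw : IsC2 w) (p : Sph n) :
    ‖sphGrad w p‖ = ‖fderiv ℝ (radialExt w) p‖ := by
  rw [Submodule.coe_norm, hw.coe_sphGrad, gradExt, LinearIsometryEquiv.norm_map]

/-- The Laplace-Beltrami operator is the Euclidean Laplacian of the radial extension. -/
theorem sphLaplacian_eq_sum (hw : IsC2 w) (p : Sph n) {ι : Type*} [Fintype ι]
    (b : OrthonormalBasis ι ℝ (Euc (n + 1))) :
    sphLaplacian w p = ∑ i, hessExt w p (b i) (b i) := by
  -- Extension by zero does not change the trace, and makes a basis of the whole space usable.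
  have h1 : sphLaplacian w p = LinearMap.trace ℝ (Euc (n + 1))
      ((Tan p).subtype ∘ₗ ((sphHess w p : Tan p →ₗ[ℝ] Tan p) ∘ₗ
        ((Tan p).orthogonalProjectionOnto : Euc (n + 1) →ₗ[ℝ] Tan p))) := by
    rw [sphLaplacian_eq_trace, LinearMap.trace_comp_comm', LinearMap.comp_assoc]
    congr 1
    ext v
    simp
  have hP : ∀ v : Euc (n + 1), ((Tan p).orthogonalProjectionOnto v : Euc (n + 1))
      = v - ⟪(p : Euc (n + 1)), v⟫ • (p : Euc (n + 1)) := by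
    intro v
    rw [Submodule.coe_orthogonalProjectionOnto_apply, Submodule.starProjection_orthogonal_val,
      Submodule.starProjection_unit_singleton ℝ (norm_coe p)]
  have hp := coe_ne_zero p
  -- Removing the radial part of `b i` leaves a cross term, by Euler's relations; these sum to 2⟪p,
  -- grad w⟫ = 0.
  have hterm : ∀ i, ⟪b i, (Tan p).subtype (sphHess w p ((Tan p).orthogonalProjectionOnto (b i)))⟫
      = hessExt w p (b i) (b i)
        + 2 * (⟪(p : Euc (n + 1)), b i⟫ * ⟪b i, gradExt w p⟫) := by
    intro i
    have : ⟪b i, (Tan p).subtype (sphHess w p ((Tan p).orthogonalProjectionOnto (b i)))⟫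
        = hessExt w p ((Tan p).orthogonalProjectionOnto (b i))
          ((Tan p).orthogonalProjectionOnto (b i)) := by
      rw [← hw.inner_sphHess, real_inner_comm, Submodule.subtype_apply,
        ← Submodule.inner_orthogonalProjectionOnto_eq_of_mem_left]
    rw [this, hP]
    simp only [map_sub, map_smul, sub_apply, smul_apply,
      hw.hessExt_apply_self hp, hw.hessExt_self_apply hp, hw.fderiv_self hp, smul_eq_mul]
    rw [real_inner_comm (gradExt w p), inner_gradExt]
    ring
  rw [h1, LinearMap.trace_eq_sum_inner _ b]
  simp only [LinearMap.comp_apply, ContinuousLinearMap.coe_coe]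
  rw [Finset.sum_congr rfl fun i _ => hterm i, Finset.sum_add_distrib, ← Finset.mul_sum,
    b.sum_inner_mul_inner, real_inner_comm, hw.inner_gradExt_self, mul_zero, add_zero]

end IsC2

/-! ### Bounds by the `C^k` norm -/

section Bounds

variable {k : ℕ} (u : CkSph n k)

theorem isC2_coe (hk : 2 ≤ k) : IsC2 (u : Sph n → ℝ) := fun _ hx =>
  (contDiffAt_radialExt u hx).of_le (by exact_mod_cast hk)

theorem norm_iteratedFDeriv_le {j : ℕ} (hj : j ≤ k) (p : Sph n) :
    ‖iteratedFDeriv ℝ j (radialExt (u : Sph n → ℝ)) (p : Euc (n + 1))‖ ≤ ‖u‖ :=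
  ((jet n k u ⟨j, Nat.lt_succ_of_le hj⟩).norm_coe_le_norm p).trans
    (norm_le_pi_norm (jet n k u) ⟨j, Nat.lt_succ_of_le hj⟩)

theorem abs_apply_le (p : Sph n) : |u p| ≤ ‖u‖ := by
  have := norm_iteratedFDeriv_le u (Nat.zero_le k) p
  rwa [norm_iteratedFDeriv_zero, radialExt_apply_coe] at this

theorem norm_sphGrad_le (hk : 2 ≤ k) (p : Sph n) : ‖sphGrad u p‖ ≤ ‖u‖ := by
  rw [(isC2_coe u hk).norm_sphGrad, ← norm_iteratedFDeriv_one]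
  exact norm_iteratedFDeriv_le u (by lia) p

theorem norm_hessExt_le (hk : 2 ≤ k) (p : Sph n) : ‖hessExt u p‖ ≤ ‖u‖ := by
  rw [hessExt, ← norm_iteratedFDeriv_one, norm_iteratedFDeriv_fderiv]
  exact norm_iteratedFDeriv_le u hk p

theorem norm_sphHess_le (hk : 2 ≤ k) (p : Sph n) : ‖sphHess u p‖ ≤ ‖u‖ :=
  ((isC2_coe u hk).norm_sphHess_le p).trans (norm_hessExt_le u hk p)

end Bounds

end RadialCalculus

/-! ### The geometry of a normal graph -/

section Geometry

variable {n : ℕ} {θ : ℝ} {u : Sph n → ℝ} {p : Sph n}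

theorem hasFDerivAt_toLp {f : Euc (n + 1) → Euc (n + 1)} {g : Euc (n + 1) → ℝ}
    {f' : Euc (n + 1) →L[ℝ] Euc (n + 1)} {g' : Euc (n + 1) →L[ℝ] ℝ} {x : Euc (n + 1)}
    (hf : HasFDerivAt f f' x) (hg : HasFDerivAt g g' x) :
    ∃ D : Euc (n + 1) →L[ℝ] Amb n,
      HasFDerivAt (fun y => (WithLp.toLp 2 (f y, g y) : Amb n)) D x ∧
        ∀ v, D v = WithLp.toLp 2 (f' v, g' v) :=
  ⟨_, ((WithLp.prodContinuousLinearEquiv 2 ℝ (Euc (n + 1)) ℝ).symm.toContinuousLinearMap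
    |>.hasFDerivAt).comp x (hf.prodMk hg), fun _ => rfl⟩

theorem graph_eq (θ : ℝ) (u : Sph n → ℝ) (p : Sph n) :
    graph θ u p = WithLp.toLp 2 (Real.sin (θ + u p) • (p : Euc (n + 1)), Real.cos (θ + u p)) := rfl

theorem geodVel_eq (θ : ℝ) (u : Sph n → ℝ) (p : Sph n) :
    geodVel θ u p
      = WithLp.toLp 2 (Real.cos (θ + u p) • (p : Euc (n + 1)), - Real.sin (θ + u p)) := by
  have hadd : HasDerivAt (fun s : ℝ => θ + s) 1 (u p) := (hasDerivAt_id _).const_add θ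
  have h1 : HasDerivAt (fun s : ℝ => Real.sin (θ + s) • (p : Euc (n + 1)))
      (Real.cos (θ + u p) • (p : Euc (n + 1))) (u p) := by
    have := hadd.sin.smul_const (p : Euc (n + 1))
    rwa [mul_one] at this
  have h2 : HasDerivAt (fun s : ℝ => Real.cos (θ + s)) (- Real.sin (θ + u p)) (u p) := by
    simpa using hadd.cos
  exact (((WithLp.prodContinuousLinearEquiv 2 ℝ (Euc (n + 1)) ℝ).symm.toContinuousLinearMap
    |>.hasFDerivAt).comp_hasDerivAt (u p) (h1.prodMk h2)).deriv

theorem graphDeriv_apply (hu : IsC2 u) (v : Tan p) :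
    graphDeriv θ u p v = WithLp.toLp 2
      ((Real.cos (θ + u p) * ⟪sphGrad u p, v⟫) • (p : Euc (n + 1))
        + Real.sin (θ + u p) • (v : Euc (n + 1)),
        - (Real.sin (θ + u p) * ⟪sphGrad u p, v⟫)) := by
  have hd := (hu.differentiableAt (coe_ne_zero p)).hasFDerivAt.const_add θ
  have h1 : HasFDerivAt (fun x : Euc (n + 1) => Real.sin (θ + radialExt u x) • x) _
      (p : Euc (n + 1)) := hd.sin.smul (hasFDerivAt_id _)
  obtain ⟨D, hD, hD'⟩ := hasFDerivAt_toLp h1 hd.cos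
  rw [graphDeriv, sphDeriv_eq (fun q => by rw [graph_eq, radialExt_apply_coe]) hD, hD',
    hu.inner_sphGrad, radialExt_apply_coe]
  simp [add_comm]

theorem inner_graphDeriv (hu : IsC2 u) (v w : Tan p) :
    ⟪graphDeriv θ u p v, graphDeriv θ u p w⟫
      = ⟪sphGrad u p, v⟫ * ⟪sphGrad u p, w⟫ + Real.sin (θ + u p) ^ 2 * ⟪v, w⟫ := by
  rw [graphDeriv_apply hu, graphDeriv_apply hu, WithLp.prod_inner_apply]
  have hv : ⟪(v : Euc (n + 1)), (p : Euc (n + 1))⟫ = 0 := by rw [real_inner_comm, inner_tan]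
  simp only [inner_add_left, inner_add_right, real_inner_smul_left, real_inner_smul_right,
    inner_coe_self, inner_tan, hv, Submodule.coe_inner]
  simp
  linear_combination (⟪(sphGrad u p : Euc (n + 1)), (v : Euc (n + 1))⟫
    * ⟪(sphGrad u p : Euc (n + 1)), (w : Euc (n + 1))⟫) * Real.sin_sq_add_cos_sq (θ + u p)

theorem inducedMetric_eq (hu : IsC2 u) :
    inducedMetric θ u p = (Real.sin (θ + u p) ^ 2) • 1
      + InnerProductSpace.rankOne ℝ (sphGrad u p) (sphGrad u p) := by
  ext1 v
  refine ext_inner_right ℝ fun w => ?_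
  rw [inducedMetric, ContinuousLinearMap.comp_apply, ContinuousLinearMap.adjoint_inner_left,
    inner_graphDeriv hu]
  simp only [add_apply, smul_apply, one_apply_eq_self,
    InnerProductSpace.rankOne_apply, inner_add_left, real_inner_smul_left]
  ring

/-- The length of the covector `(du, 1)` at `p`; it equals `⟪γ̇, ν⟫⁻¹`. -/
def slope (θ : ℝ) (u : Sph n → ℝ) (p : Sph n) : ℝ :=
  Real.sqrt (1 + ‖sphGrad u p‖ ^ 2 / Real.sin (θ + u p) ^ 2)

theorem slope_sq (θ : ℝ) (u : Sph n → ℝ) (p : Sph n) :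
    slope θ u p ^ 2 = 1 + ‖sphGrad u p‖ ^ 2 / Real.sin (θ + u p) ^ 2 :=
  Real.sq_sqrt (by positivity)

theorem slope_pos (θ : ℝ) (u : Sph n → ℝ) (p : Sph n) : 0 < slope θ u p :=
  Real.sqrt_pos.2 (by positivity)

/-- The normal direction with `γ̇`-component one. -/
def conormal (θ : ℝ) (u : Sph n → ℝ) (p : Sph n) : Amb n :=
  WithLp.toLp 2 (Real.cos (θ + u p) • (p : Euc (n + 1))
    - (Real.sin (θ + u p))⁻¹ • (sphGrad u p : Euc (n + 1)), - Real.sin (θ + u p))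

theorem inner_conormal_graphDeriv (hu : IsC2 u) (hs : 0 < Real.sin (θ + u p)) (v : Tan p) :
    ⟪conormal θ u p, graphDeriv θ u p v⟫ = 0 := by
  rw [graphDeriv_apply hu, conormal, WithLp.prod_inner_apply]
  have h1 : ⟪(sphGrad u p : Euc (n + 1)), (p : Euc (n + 1))⟫ = 0 := by
    rw [real_inner_comm, inner_tan]
  simp only [inner_add_right, inner_sub_left, real_inner_smul_left,
    real_inner_smul_right, inner_coe_self, inner_tan, h1, Submodule.coe_inner]
  simp
  field_simp
  linear_combination (⟪(sphGrad u p : Euc (n + 1)), (v : Euc (n + 1))⟫)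
    * Real.sin_sq_add_cos_sq (θ + u p)

theorem inner_conormal_graph :
    ⟪conormal θ u p, graph θ u p⟫ = 0 := by
  rw [graph_eq, conormal, WithLp.prod_inner_apply]
  have h1 : ⟪(sphGrad u p : Euc (n + 1)), (p : Euc (n + 1))⟫ = 0 := by
    rw [real_inner_comm, inner_tan]
  simp only [inner_sub_left, real_inner_smul_left,
    real_inner_smul_right, inner_coe_self, h1]
  simp
  ring

theorem inner_graph_graphDeriv (hu : IsC2 u) (v : Tan p) :
    ⟪graph θ u p, graphDeriv θ u p v⟫ = 0 := by
  rw [graph_eq, graphDeriv_apply hu, WithLp.prod_inner_apply]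
  simp only [inner_add_right, real_inner_smul_left,
    real_inner_smul_right, inner_coe_self, inner_tan]
  simp
  ring

theorem inner_geodVel_conormal :
    ⟪geodVel θ u p, conormal θ u p⟫ = 1 := by
  rw [geodVel_eq, conormal, WithLp.prod_inner_apply]
  simp only [inner_sub_right, real_inner_smul_left, real_inner_smul_right, inner_coe_self,
    inner_tan]
  simp
  linear_combination Real.sin_sq_add_cos_sq (θ + u p)

theorem norm_conormal : ‖conormal θ u p‖ = slope θ u p := by
  rw [slope, norm_eq_sqrt_real_inner, conormal, WithLp.prod_inner_apply]
  have h1 : ⟪(sphGrad u p : Euc (n + 1)), (p : Euc (n + 1))⟫ = 0 := by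
    rw [real_inner_comm, inner_tan]
  simp only [inner_sub_left, inner_sub_right, real_inner_smul_left, real_inner_smul_right,
    inner_coe_self, inner_tan, h1]
  rw [real_inner_self_eq_norm_sq, Submodule.coe_norm]
  simp only [real_inner_self_eq_norm_sq, norm_neg, Real.norm_eq_abs, sq_abs]
  congr 1
  linear_combination Real.sin_sq_add_cos_sq (θ + u p)

/-- `conormal` is orthogonal to the position and to the graph, while γ̇ − W⁻²·`conormal` is tangent
to the graph. Hence W⁻²·`conormal` is the projection of γ̇, and its norm is W⁻¹. -/
theorem normal_eq (hu : IsC2 u) (hs : 0 < Real.sin (θ + u p)) :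
    normal θ u p = (slope θ u p)⁻¹ • conormal θ u p := by
  have hW := slope_pos θ u p
  have hW2 := slope_sq θ u p
  have hproj : ((ℝ ∙ graph θ u p) ⊔ (graphDeriv θ u p).range)ᗮ.starProjection (geodVel θ u p)
      = ((slope θ u p) ^ 2)⁻¹ • conormal θ u p := by
    refine Submodule.eq_starProjection_of_mem_orthogonal ?_ ?_
    · refine Submodule.smul_mem _ _ ?_
      rw [← Submodule.inf_orthogonal, Submodule.mem_inf]
      refine ⟨Submodule.mem_orthogonal_singleton_iff_inner_left.2 inner_conormal_graph, ?_⟩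
      rw [Submodule.mem_orthogonal']
      rintro _ ⟨v, rfl⟩
      exact inner_conormal_graphDeriv hu hs v
    · refine Submodule.le_orthogonal_orthogonal _ (Submodule.mem_sup_right ?_)
      -- The factor is forced by comparing the components along grad u.
      refine ⟨((slope θ u p) ^ 2 * Real.sin (θ + u p) ^ 2)⁻¹ • sphGrad u p, ?_⟩
      rw [ContinuousLinearMap.coe_coe, graphDeriv_apply hu, geodVel_eq, conormal]
      refine WithLp.ofLp_injective 2 ?_
      rw [WithLp.ofLp_sub, WithLp.ofLp_smul, real_inner_smul_right, real_inner_self_eq_norm_sq]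
      have h2 : ‖sphGrad u p‖ ^ 2 = (slope θ u p ^ 2 - 1) * Real.sin (θ + u p) ^ 2 := by
        rw [hW2]; field_simp; ring
      refine Prod.ext ?_ ?_
      · simp only [Prod.smul_mk, Prod.mk_sub_mk, Submodule.coe_smul, h2]
        match_scalars
        · field_simp
        · field_simp
      · simp only [Prod.smul_mk, Prod.mk_sub_mk, h2, smul_eq_mul]
        field_simp
        ring
  simp only [normal, hproj]
  rw [norm_smul, norm_conormal, smul_smul, Real.norm_eq_abs, abs_of_pos (by positivity)]
  congr 1
  field_simp

theorem tilt_eq (hu : IsC2 u) (hs : 0 < Real.sin (θ + u p)) : tilt θ u p = slope θ u p := by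
  rw [tilt, normal_eq hu hs, real_inner_smul_right, inner_geodVel_conormal, mul_one, inv_inv]

/-- Write ν = W⁻¹·`conormal`. The derivative of W⁻¹ multiplies `conormal`, which is orthogonal to
dX_u w, so only the differentiability of W matters. The projection off the position vector is
invisible too, as dX_u w is orthogonal to that vector. -/
theorem inner_normalCovDeriv (hu : IsC2 u) (hs : ∀ q, 0 < Real.sin (θ + u q)) (v w : Tan p) :
    ⟪normalCovDeriv θ u p v, graphDeriv θ u p w⟫
      = (slope θ u p)⁻¹ * (Real.sin (θ + u p) * Real.cos (θ + u p) * ⟪v, w⟫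
        - ⟪sphHess u p v, w⟫
        + 2 * Real.cot (θ + u p) * (⟪sphGrad u p, v⟫ * ⟪sphGrad u p, w⟫)) := by
  have hp := coe_ne_zero p
  have hsp := hs p
  have hd := (hu.differentiableAt hp).hasFDerivAt.const_add θ
  obtain ⟨D, hD, hD'⟩ := hu.hasFDerivAt_gradExt hp
  have hs' : Real.sin (θ + radialExt u p) ≠ 0 := by
    rw [radialExt_apply_coe]; exact hsp.ne'
  have hinv : HasFDerivAt (fun x => (Real.sin (θ + radialExt u x))⁻¹) _ (p : Euc (n + 1)) :=
    HasDerivAt.comp_hasFDerivAt (f := fun x => Real.sin (θ + radialExt u x))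
      (p : Euc (n + 1)) (hasDerivAt_inv hs') hd.sin
  have htan : HasFDerivAt (fun x => Real.cos (θ + radialExt u x) • x
      - (Real.sin (θ + radialExt u x))⁻¹ • gradExt u x) _ (p : Euc (n + 1)) :=
    (hd.cos.smul (hasFDerivAt_id _)).sub (hinv.smul hD)
  have hvert : HasFDerivAt (fun x => - Real.sin (θ + radialExt u x)) _ (p : Euc (n + 1)) :=
    hd.sin.neg
  obtain ⟨M, hM, hM'⟩ := hasFDerivAt_toLp htan hvert
  have hslope : DifferentiableAt ℝ (fun x => (Real.sqrt (1 + ‖gradExt u x‖ ^ 2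
      / Real.sin (θ + radialExt u x) ^ 2))⁻¹) (p : Euc (n + 1)) := by
    refine DifferentiableAt.inv (DifferentiableAt.sqrt ?_ (by positivity)) (by positivity)
    have hsq : DifferentiableAt ℝ (fun x => Real.sin (θ + radialExt u x) ^ 2)
        (p : Euc (n + 1)) := hd.sin.differentiableAt.pow 2
    have hdiv : DifferentiableAt ℝ (fun x => ‖gradExt u x‖ ^ 2
        / Real.sin (θ + radialExt u x) ^ 2) (p : Euc (n + 1)) :=
      (hD.differentiableAt.norm_sq ℝ).mul (hsq.inv (pow_ne_zero 2 hs'))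
    exact hdiv.const_add 1
  have hext : ∀ q : Sph n, normal θ u q = (Real.sqrt (1 + ‖gradExt u q‖ ^ 2
      / Real.sin (θ + radialExt u q) ^ 2))⁻¹ • (WithLp.toLp 2
        (Real.cos (θ + radialExt u q) • (q : Euc (n + 1))
          - (Real.sin (θ + radialExt u q))⁻¹ • gradExt u q,
        - Real.sin (θ + radialExt u q)) : Amb n) := by
    intro q
    rw [normal_eq hu (hs q), slope, conormal, radialExt_apply_coe, Submodule.coe_norm,
      hu.coe_sphGrad]
  have hX : graphDeriv θ u p w ∈ (ℝ ∙ graph θ u p)ᗮ :=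
    Submodule.mem_orthogonal_singleton_iff_inner_right.2 (inner_graph_graphDeriv hu w)
  rw [normalCovDeriv, ContinuousLinearMap.comp_apply, Submodule.inner_starProjection_left_eq_right,
    Submodule.starProjection_eq_self_iff.2 hX, sphDeriv_eq hext (hslope.hasFDerivAt.smul hM)]
  have hc := inner_conormal_graphDeriv hu hsp w
  simp only [add_apply, smul_apply, ContinuousLinearMap.smulRight_apply, inner_add_left,
    real_inner_smul_left, hM', radialExt_apply_coe, id, ← hu.coe_sphGrad, ← Submodule.coe_norm]
  rw [show (WithLp.toLp 2 (Real.cos (θ + u p) • (p : Euc (n + 1))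
    - (Real.sin (θ + u p))⁻¹ • (sphGrad u p : Euc (n + 1)), - Real.sin (θ + u p)) : Amb n)
      = conormal θ u p from rfl, hc, mul_zero, add_zero]
  change (slope θ u p)⁻¹ * _ = _
  congr 1
  rw [graphDeriv_apply hu, WithLp.prod_inner_apply]
  have h1 : ⟪(sphGrad u p : Euc (n + 1)), (p : Euc (n + 1))⟫ = 0 := by
    rw [real_inner_comm, inner_tan]
  have hv : ⟪(v : Euc (n + 1)), (p : Euc (n + 1))⟫ = 0 := by rw [real_inner_comm, inner_tan]
  have hdv : fderiv ℝ (radialExt u) p v = ⟪(sphGrad u p : Euc (n + 1)), (v : Euc (n + 1))⟫ :=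
    (hu.inner_sphGrad p v).symm
  simp only [add_apply, sub_apply, neg_apply, smul_apply, ContinuousLinearMap.smulRight_apply,
    ContinuousLinearMap.id_apply, inner_add_left, inner_sub_left, inner_add_right,
    real_inner_smul_left, real_inner_smul_right, inner_coe_self, inner_tan, hD',
    hu.hessExt_apply_self hp, h1, hv, hdv, hu.inner_sphHess, Real.cot_eq_cos_div_sin,
    Submodule.coe_inner, smul_eq_mul]
  simp
  field_simp
  ring

theorem secondFundamentalForm_eq (hu : IsC2 u) (hs : ∀ q, 0 < Real.sin (θ + u q)) :
    secondFundamentalForm θ u p = (slope θ u p)⁻¹ •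
      ((Real.sin (θ + u p) * Real.cos (θ + u p)) • 1 - sphHess u p
        + (2 * Real.cot (θ + u p)) • InnerProductSpace.rankOne ℝ (sphGrad u p) (sphGrad u p)) := by
  ext1 v
  refine ext_inner_right ℝ fun w => ?_
  rw [secondFundamentalForm, ContinuousLinearMap.comp_apply,
    ContinuousLinearMap.adjoint_inner_left, inner_normalCovDeriv hu hs]
  simp only [add_apply, sub_apply, smul_apply, one_apply_eq_self,
    InnerProductSpace.rankOne_apply, inner_add_left, inner_sub_left, real_inner_smul_left]

end Geometry

/-! ### Real eigenvalues -/

section Eigenvalues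

open Polynomial

/-- Sylvester's identity. For an inclusion and a projection it relates an endomorphism of a subspace
to its extension by zero. -/
theorem charpoly_comp_comm {M N : Type*} [AddCommGroup M] [Module ℝ M] [AddCommGroup N]
    [Module ℝ N] [FiniteDimensional ℝ M] [FiniteDimensional ℝ N] (f : M →ₗ[ℝ] N)
    (g : N →ₗ[ℝ] M) :
    X ^ Module.finrank ℝ M * (f ∘ₗ g).charpoly = X ^ Module.finrank ℝ N * (g ∘ₗ f).charpoly := by
  classical
  let b := Module.finBasis ℝ M
  let c := Module.finBasis ℝ N
  have h := Matrix.charpoly_mul_comm' (LinearMap.toMatrix b c f) (LinearMap.toMatrix c b g)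
  rw [← LinearMap.toMatrix_comp, ← LinearMap.toMatrix_comp, LinearMap.charpoly_toMatrix,
    LinearMap.charpoly_toMatrix] at h
  simpa using h

theorem charpoly_mul_comm {M : Type*} [AddCommGroup M] [Module ℝ M] [FiniteDimensional ℝ M]
    (f g : M →ₗ[ℝ] M) : (f * g).charpoly = (g * f).charpoly := by
  have h := charpoly_comp_comm f g
  exact mul_left_cancel₀ (pow_ne_zero _ X_ne_zero) h

/-- The roots of the characteristic polynomial in increasing order. -/
def sortedEigs {M : Type*} [AddCommGroup M] [Module ℝ M] [FiniteDimensional ℝ M] (n : ℕ)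
    (f : M →ₗ[ℝ] M) : Fin n → ℝ := fun i => (f.charpoly.roots.sort (· ≤ ·)).getD i 0

variable {M : Type*} [NormedAddCommGroup M] [InnerProductSpace ℝ M] [FiniteDimensional ℝ M]
  {n : ℕ} {A : M →L[ℝ] M}

theorem ofFn_sortedEigs (hn : Module.finrank ℝ M = n)
    (hA : (A : M →ₗ[ℝ] M).charpoly.Splits) :
    List.ofFn (sortedEigs n (A : M →ₗ[ℝ] M)) = (A : M →ₗ[ℝ] M).charpoly.roots.sort (· ≤ ·) := by
  -- Splitting gives exactly `n` roots, so the default value 0 in `getD` is never reached.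
  have hlen : ((A : M →ₗ[ℝ] M).charpoly.roots.sort (· ≤ ·)).length = n := by
    rw [Multiset.length_sort, splits_iff_card_roots.1 hA, LinearMap.charpoly_natDegree, hn]
  refine List.ext_getElem (by simp [hlen]) fun i h1 h2 => ?_
  rw [List.getElem_ofFn, sortedEigs, List.getD_eq_getElem _ _ h2]

theorem map_sortedEigs (hn : Module.finrank ℝ M = n)
    (hA : (A : M →ₗ[ℝ] M).charpoly.Splits) :
    Finset.univ.val.map (sortedEigs n (A : M →ₗ[ℝ] M)) = (A : M →ₗ[ℝ] M).charpoly.roots := by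
  rw [Fin.univ_val_map, ofFn_sortedEigs hn hA, Multiset.sort_eq]

theorem sum_sortedEigs (hn : Module.finrank ℝ M = n)
    (hA : (A : M →ₗ[ℝ] M).charpoly.Splits) :
    ∑ i, sortedEigs n (A : M →ₗ[ℝ] M) i = LinearMap.trace ℝ M A := by
  rw [Module.End.trace_eq_sum_roots_charpoly_of_splits hA, ← map_sortedEigs hn hA]
  rfl

theorem prod_sortedEigs (hn : Module.finrank ℝ M = n)
    (hA : (A : M →ₗ[ℝ] M).charpoly.Splits) :
    ∏ i, (X - C (sortedEigs n (A : M →ₗ[ℝ] M) i)) = (A : M →ₗ[ℝ] M).charpoly := by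
  conv_rhs => rw [hA.eq_prod_roots_of_monic (LinearMap.charpoly_monic _), ← map_sortedEigs hn hA,
    Multiset.map_map]
  rfl

theorem monotone_sortedEigs (hn : Module.finrank ℝ M = n)
    (hA : (A : M →ₗ[ℝ] M).charpoly.Splits) :
    Monotone (sortedEigs n (A : M →ₗ[ℝ] M)) := by
  rw [← List.sortedLE_ofFn_iff, ofFn_sortedEigs hn hA]
  exact (Multiset.pairwise_sort _ _).sortedLE

/-- An eigenvector of `A` for κ is one of A − c for κ − c. Symmetry of `A` plays no role, which
matters because g⁻¹h need not be symmetric for the round inner product. -/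
theorem abs_sortedEigs_sub_le (hn : Module.finrank ℝ M = n)
    (hA : (A : M →ₗ[ℝ] M).charpoly.Splits) (c : ℝ) (i : Fin n) :
    |sortedEigs n (A : M →ₗ[ℝ] M) i - c| ≤ ‖A - c • (1 : M →L[ℝ] M)‖ := by
  set κ := sortedEigs n (A : M →ₗ[ℝ] M) i with hκ
  have hroot : (A : M →ₗ[ℝ] M).charpoly.IsRoot κ := by
    rw [← prod_sortedEigs hn hA, IsRoot.def, eval_prod]
    exact Finset.prod_eq_zero (Finset.mem_univ i) (by simp [hκ])
  obtain ⟨v, hv⟩ := (Module.End.hasEigenvalue_iff_isRoot_charpoly _ _).2 hroot |>.exists_hasEigenvector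
  have hAv : A v = κ • v := hv.apply_eq_smul
  have hv0 : 0 < ‖v‖ := norm_pos_iff.2 hv.2
  have h := (A - c • (1 : M →L[ℝ] M)).le_opNorm v
  rw [sub_apply, smul_apply, one_apply_eq_self, hAv, ← sub_smul, norm_smul] at h
  exact le_of_mul_le_mul_right h hv0

theorem abs_trace_le (hn : Module.finrank ℝ M = n) (A : M →L[ℝ] M) :
    |LinearMap.trace ℝ M A| ≤ n * ‖A‖ := by
  rw [LinearMap.trace_eq_sum_inner _ (stdOrthonormalBasis ℝ M)]
  refine (Finset.abs_sum_le_sum_abs _ _).trans ?_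
  refine (Finset.sum_le_card_nsmul _ _ ‖A‖ fun i _ => ?_).trans (by simp [hn])
  refine (abs_real_inner_le_norm _ _).trans ?_
  simpa using A.le_opNorm (stdOrthonormalBasis ℝ M i)

/-- Continuity of the ordered eigenvalues of endomorphisms of a varying subspace. -/
theorem continuousAt_sortedEigs {E α : Type*} [NormedAddCommGroup E] [InnerProductSpace ℝ E]
    [FiniteDimensional ℝ E] [TopologicalSpace α] {S : α → Submodule ℝ E}
    {A : (a : α) → S a →L[ℝ] S a} {a : α} (hn : ∀ a, Module.finrank ℝ (S a) = n)
    (hA : ∀ a, (A a : S a →ₗ[ℝ] S a).charpoly.Splits)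
    (hc : ContinuousAt (fun a => (S a).subtypeL.comp
      ((A a).comp (S a).orthogonalProjectionOnto)) a) :
    ContinuousAt (fun a => sortedEigs n (A a : S a →ₗ[ℝ] S a)) a := by
  set B := fun a => (S a).subtypeL.comp ((A a).comp (S a).orthogonalProjectionOnto) with hB
  have hBA : ∀ a, ‖A a‖ ≤ ‖B a‖ := fun a => by
    refine ContinuousLinearMap.opNorm_le_bound _ (norm_nonneg (B a)) fun v => ?_
    have := (B a).le_opNorm v
    simpa [hB] using this
  -- The subspaces vary, so characteristic polynomials are compared through extensions by zero to
  -- the fixed space `E`. The powers of `X` are divided out below, whence the restriction to `t ≠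
  -- 0`.
  have hpoly : ∀ a, X ^ n * (B a : E →ₗ[ℝ] E).charpoly
      = X ^ Module.finrank ℝ E * (A a : S a →ₗ[ℝ] S a).charpoly := fun a => by
    have h := charpoly_comp_comm (S a).subtype
      ((A a : S a →ₗ[ℝ] S a) ∘ₗ ((S a).orthogonalProjectionOnto : E →ₗ[ℝ] S a))
    rw [hn, LinearMap.comp_assoc] at h
    have h1 : (((S a).orthogonalProjectionOnto : E →ₗ[ℝ] S a) ∘ₗ (S a).subtype) = LinearMap.id := by
      ext v; simp
    rw [h1, LinearMap.comp_id] at h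
    exact h
  have hev : ∀ (t : ℝ), t ≠ 0 → ContinuousAt
      (fun a => (A a : S a →ₗ[ℝ] S a).charpoly.eval t) a := fun t ht => by
    have h1 : ∀ a, (A a : S a →ₗ[ℝ] S a).charpoly.eval t
        = (t ^ Module.finrank ℝ E)⁻¹ * (t ^ n * (t • (1 : E →L[ℝ] E) - B a).det) := fun a => by
      have h := congrArg (eval t) (hpoly a)
      rw [eval_mul, eval_mul, eval_pow, eval_pow, eval_X, LinearMap.eval_charpoly] at h
      have h2 : (t • (1 : E →L[ℝ] E) - B a).det
          = LinearMap.det ((algebraMap ℝ (Module.End ℝ E)) t - (B a : E →ₗ[ℝ] E)) := by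
        rw [ContinuousLinearMap.det]
        congr 1
      rw [h2, h]
      field_simp
    simp_rw [h1]
    refine ContinuousAt.mul continuousAt_const (continuousAt_const.mul ?_)
    exact ContinuousLinearMap.continuous_det.continuousAt.comp (continuousAt_const.sub hc)
  -- The eigenvalues are bounded near `a`, so along an ultrafilter they converge to some κ. This κ
  -- is monotone and has the right characteristic polynomial, which leaves only one candidate.
  rw [ContinuousAt, tendsto_iff_ultrafilter]
  intro 𝒰 h𝒰
  have hbd : ∀ᶠ b in (𝒰 : Filter α), sortedEigs n (A b : S b →ₗ[ℝ] S b)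
      ∈ Metric.closedBall (0 : Fin n → ℝ) (‖B a‖ + 1) := by
    have : ∀ᶠ b in 𝓝 a, ‖B b‖ < ‖B a‖ + 1 := hc.norm.eventually_lt_const (lt_add_one _)
    filter_upwards [h𝒰 this] with b hb
    rw [mem_closedBall_zero_iff, pi_norm_le_iff_of_nonneg (by positivity)]
    intro i
    have := abs_sortedEigs_sub_le (hn b) (hA b) 0 i
    rw [sub_zero, zero_smul, sub_zero] at this
    exact (this.trans (hBA b)).trans (le_of_lt hb)
  obtain ⟨κ, -, hκ⟩ := (isCompact_closedBall (0 : Fin n → ℝ) (‖B a‖ + 1)).ultrafilter_le_nhds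
    (𝒰.map fun b => sortedEigs n (A b : S b →ₗ[ℝ] S b)) (le_principal_iff.2 hbd)
  have hκ' : Tendsto (fun b => sortedEigs n (A b : S b →ₗ[ℝ] S b)) 𝒰 (𝓝 κ) := hκ
  suffices h : κ = sortedEigs n (A a : S a →ₗ[ℝ] S a) by rwa [← h]
  have hmono : Monotone κ := fun i j hij =>
    le_of_tendsto_of_tendsto ((continuous_apply i).continuousAt.tendsto.comp hκ')
      ((continuous_apply j).continuousAt.tendsto.comp hκ')
      (Eventually.of_forall fun b => monotone_sortedEigs (hn b) (hA b) hij)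
  have hprod : ∏ i, (X - C (κ i)) = (A a : S a →ₗ[ℝ] S a).charpoly := by
    refine Polynomial.eq_of_infinite_eval_eq _ _
      ((Set.finite_singleton (0 : ℝ)).infinite_compl.mono fun t ht => ?_)
    refine tendsto_nhds_unique (l := (𝒰 : Filter α)) ?_ ((hev t ht).tendsto.mono_left h𝒰)
    have h1 : ∀ b, (A b : S b →ₗ[ℝ] S b).charpoly.eval t
        = ∏ i, (t - sortedEigs n (A b : S b →ₗ[ℝ] S b) i) := fun b => by
      rw [← prod_sortedEigs (hn b) (hA b), eval_prod]; simp
    simp_rw [h1, eval_prod, eval_sub, eval_X, eval_C]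
    exact tendsto_finsetProd _ fun i _ =>
      tendsto_const_nhds.sub ((continuous_apply i).continuousAt.tendsto.comp hκ')
  have hroots : Finset.univ.val.map κ = (A a : S a →ₗ[ℝ] S a).charpoly.roots := by
    rw [← hprod, ← roots_multiset_prod_X_sub_C (Finset.univ.val.map κ), Multiset.map_map]
    rfl
  have hlist : List.ofFn κ = List.ofFn (sortedEigs n (A a : S a →ₗ[ℝ] S a)) := by
    refine List.Perm.eq_of_pairwise (le := (· ≤ ·)) ?_ ?_ ?_ ?_
    · exact fun _ _ _ _ h1 h2 => le_antisymm h1 h2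
    · exact (List.sortedLE_ofFn_iff.2 hmono).pairwise
    · exact (List.sortedLE_ofFn_iff.2 (monotone_sortedEigs (hn a) (hA a))).pairwise
    · rw [← Multiset.coe_eq_coe, ← Fin.univ_val_map, ← Fin.univ_val_map, hroots,
        map_sortedEigs (hn a) (hA a)]
  exact List.ofFn_injective hlist

end Eigenvalues

/-! ### The Weingarten map, the area density and their continuity -/

section Weingarten

/-- With r = ξ⊗ξ and t = ‖ξ‖², the metric, its inverse and the root of its inverse all lie in the
span of 1 and r, where products reduce to scalar arithmetic. -/
theorem one_add_smul_mul_one_add_smul {R : Type*} [Ring R] [Algebra ℝ R] {r : R} {t : ℝ}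
    (hr : r * r = t • r) (a b c d : ℝ) :
    (a • (1 : R) + b • r) * (c • (1 : R) + d • r)
      = (a * c) • (1 : R) + (a * d + b * c + b * d * t) • r := by
  simp only [mul_add, add_mul, smul_mul_assoc, mul_smul_comm, one_mul, mul_one, hr]
  module

variable {n : ℕ} {θ : ℝ} {u : Sph n → ℝ} {p : Sph n}

theorem finrank_tan (p : Sph n) : Module.finrank ℝ (Tan p) = n := by
  have : Fact (Module.finrank ℝ (Euc (n + 1)) = n + 1) := ⟨finrank_euclideanSpace_fin⟩
  exact Submodule.finrank_orthogonal_span_singleton (coe_ne_zero p)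

/-- `ξ ⊗ ξ` for the gradient `ξ` of `u`. -/
def gradSq (u : Sph n → ℝ) (p : Sph n) : Tan p →L[ℝ] Tan p :=
  InnerProductSpace.rankOne ℝ (sphGrad u p) (sphGrad u p)

theorem gradSq_mul_self (u : Sph n → ℝ) (p : Sph n) :
    gradSq u p * gradSq u p = (‖sphGrad u p‖ ^ 2) • gradSq u p := by
  rw [gradSq, ContinuousLinearMap.mul_def, InnerProductSpace.rankOne_comp_rankOne,
    real_inner_self_eq_norm_sq]

theorem inner_gradSq (u : Sph n → ℝ) (p : Sph n) (v w : Tan p) :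
    ⟪gradSq u p v, w⟫ = ⟪v, gradSq u p w⟫ := by
  simp only [gradSq, InnerProductSpace.rankOne_apply, real_inner_smul_left, real_inner_smul_right]
  rw [real_inner_comm v]
  ring

theorem norm_sq_sphGrad (hs : 0 < Real.sin (θ + u p)) :
    ‖sphGrad u p‖ ^ 2 = (slope θ u p ^ 2 - 1) * Real.sin (θ + u p) ^ 2 := by
  rw [slope_sq]; field_simp; ring

/-- The inverse of the induced metric. -/
def metricInv (θ : ℝ) (u : Sph n → ℝ) (p : Sph n) : Tan p →L[ℝ] Tan p :=
  (Real.sin (θ + u p) ^ 2)⁻¹ • (1 - (Real.sin (θ + u p) ^ 2 * slope θ u p ^ 2)⁻¹ • gradSq u p)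

/-- The square root of the inverse of the induced metric. -/
def metricInvSqrt (θ : ℝ) (u : Sph n → ℝ) (p : Sph n) : Tan p →L[ℝ] Tan p :=
  (Real.sin (θ + u p))⁻¹ • (1 - (Real.sin (θ + u p) ^ 2 * slope θ u p * (slope θ u p + 1))⁻¹
    • gradSq u p)

theorem metricInv_eq (θ : ℝ) (u : Sph n → ℝ) (p : Sph n) :
    metricInv θ u p = (Real.sin (θ + u p) ^ 2)⁻¹ • 1
      + (-((Real.sin (θ + u p) ^ 2)⁻¹ * (Real.sin (θ + u p) ^ 2 * slope θ u p ^ 2)⁻¹))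
        • gradSq u p := by
  rw [metricInv]; module

theorem metricInvSqrt_mul_self (hs : 0 < Real.sin (θ + u p)) :
    metricInvSqrt θ u p * metricInvSqrt θ u p = metricInv θ u p := by
  have hW := slope_pos θ u p
  have h1 : metricInvSqrt θ u p = (Real.sin (θ + u p))⁻¹ • 1
      + (-((Real.sin (θ + u p))⁻¹ * (Real.sin (θ + u p) ^ 2 * slope θ u p
        * (slope θ u p + 1))⁻¹)) • gradSq u p := by
    rw [metricInvSqrt]; module
  rw [h1, one_add_smul_mul_one_add_smul (gradSq_mul_self u p), metricInv_eq, norm_sq_sphGrad hs]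
  congr 2
  · field_simp
  · field_simp
    ring

theorem inner_metricInvSqrt (v w : Tan p) :
    ⟪metricInvSqrt θ u p v, w⟫ = ⟪v, metricInvSqrt θ u p w⟫ := by
  simp only [metricInvSqrt, sub_apply, smul_apply, one_apply_eq_self, real_inner_smul_left,
    real_inner_smul_right, inner_sub_left, inner_sub_right, inner_gradSq]

theorem ringInverse_inducedMetric (hu : IsC2 u) (hs : 0 < Real.sin (θ + u p)) :
    Ring.inverse (inducedMetric θ u p) = metricInv θ u p := by
  have hW := slope_pos θ u p
  have h0 : inducedMetric θ u p = (Real.sin (θ + u p) ^ 2) • 1 + (1 : ℝ) • gradSq u p := by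
    rw [inducedMetric_eq hu, ← gradSq, one_smul]
  have h3 : (1 : Tan p →L[ℝ] Tan p) = (1 : ℝ) • 1 + (0 : ℝ) • gradSq u p := by module
  have h1 : inducedMetric θ u p * metricInv θ u p = 1 := by
    rw [h0, metricInv_eq, one_add_smul_mul_one_add_smul (gradSq_mul_self u p),
      norm_sq_sphGrad hs]
    refine Eq.trans ?_ h3.symm
    congr 2
    · field_simp
    · field_simp
      ring
  have h2 : metricInv θ u p * inducedMetric θ u p = 1 := by
    rw [h0, metricInv_eq, one_add_smul_mul_one_add_smul (gradSq_mul_self u p),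
      norm_sq_sphGrad hs]
    refine Eq.trans ?_ h3.symm
    congr 2
    · field_simp
    · field_simp
      ring
  exact Ring.inverse_unit ⟨_, _, h1, h2⟩

theorem weingarten_eq (hu : IsC2 u) (hs : ∀ q, 0 < Real.sin (θ + u q)) :
    weingarten θ u p = metricInv θ u p * ((slope θ u p)⁻¹ •
      ((Real.sin (θ + u p) * Real.cos (θ + u p)) • 1 - sphHess u p
        + (2 * Real.cot (θ + u p)) • gradSq u p)) := by
  rw [weingarten, ringInverse_inducedMetric hu (hs p), secondFundamentalForm_eq hu hs]
  rfl

/-- With g⁻¹ = S², the product S·S·h has the same characteristic polynomial as S·h·S, which is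
symmetric. -/
theorem splits_charpoly_weingarten (hu : IsC2 u) (hs : ∀ q, 0 < Real.sin (θ + u q)) :
    (weingarten θ u p : Tan p →ₗ[ℝ] Tan p).charpoly.Splits := by
  rw [weingarten_eq hu hs, ← metricInvSqrt_mul_self (hs p)]
  set S := metricInvSqrt θ u p with hS
  set h := (slope θ u p)⁻¹ • ((Real.sin (θ + u p) * Real.cos (θ + u p)) • 1 - sphHess u p
        + (2 * Real.cot (θ + u p)) • gradSq u p) with hh
  have h1 : ((S * S * h : Tan p →L[ℝ] Tan p) : Tan p →ₗ[ℝ] Tan p)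
      = (S : Tan p →ₗ[ℝ] Tan p) * ((S : Tan p →ₗ[ℝ] Tan p) * (h : Tan p →ₗ[ℝ] Tan p)) := rfl
  rw [h1, charpoly_mul_comm]
  refine LinearMap.IsSymmetric.splits_charpoly fun v w => ?_
  have hsym : ∀ v w : Tan p, ⟪h v, w⟫ = ⟪v, h w⟫ := fun v w => by
    simp only [hh, add_apply, sub_apply, smul_apply, one_apply_eq_self, real_inner_smul_left,
      real_inner_smul_right, inner_sub_left, inner_sub_right, inner_add_left, inner_add_right,
      inner_gradSq, hu.sphHess_symm]
  change ⟪S (h (S v)), w⟫ = ⟪v, S (h (S w))⟫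
  rw [inner_metricInvSqrt, hsym, ← inner_metricInvSqrt]

theorem sum_principalCurvatures (hu : IsC2 u) (hs : ∀ q, 0 < Real.sin (θ + u q)) :
    ∑ i, principalCurvatures θ u p i
      = LinearMap.trace ℝ (Tan p) (weingarten θ u p : Tan p →ₗ[ℝ] Tan p) :=
  sum_sortedEigs (finrank_tan p) (splits_charpoly_weingarten hu hs)

theorem norm_principalCurvatures_sub_le (hu : IsC2 u) (hs : ∀ q, 0 < Real.sin (θ + u q))
    (c : ℝ) : ‖principalCurvatures θ u p - fun _ => c‖
      ≤ ‖weingarten θ u p - c • (1 : Tan p →L[ℝ] Tan p)‖ := by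
  refine (pi_norm_le_iff_of_nonneg
    (norm_nonneg (weingarten θ u p - c • (1 : Tan p →L[ℝ] Tan p)))).2 fun i => ?_
  exact abs_sortedEigs_sub_le (finrank_tan p) (splits_charpoly_weingarten hu hs) c i

/-- The area density of the graph with respect to the round sphere. -/
theorem sqrt_det_inducedMetric (hu : IsC2 u) (hs : 0 < Real.sin (θ + u p)) :
    Real.sqrt (LinearMap.det (inducedMetric θ u p : Tan p →ₗ[ℝ] Tan p))
      = Real.sin (θ + u p) ^ n * slope θ u p := by
  -- Up to the scalar sin², the metric is a transvection, of determinant 1 + ‖ξ‖²/sin² = W².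
  have h1 : (inducedMetric θ u p : Tan p →ₗ[ℝ] Tan p) = (Real.sin (θ + u p) ^ 2) •
      LinearMap.transvection ((Real.sin (θ + u p) ^ 2)⁻¹ •
        (innerSL ℝ (sphGrad u p) : Tan p →ₗ[ℝ] ℝ)) (sphGrad u p) := by
    ext1 v
    rw [inducedMetric_eq hu]
    simp [LinearMap.transvection.apply, smul_add, smul_smul, hs.ne']
  rw [h1, LinearMap.det_smul, finrank_tan, LinearMap.transvection.det]
  have h2 : 1 + ((Real.sin (θ + u p) ^ 2)⁻¹ •
      (innerSL ℝ (sphGrad u p) : Tan p →ₗ[ℝ] ℝ)) (sphGrad u p) = slope θ u p ^ 2 := by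
    rw [slope_sq]
    simp
    ring
  rw [h2, ← pow_mul, mul_comm 2 n, pow_mul, ← mul_pow]
  have := slope_pos θ u p
  exact Real.sqrt_sq (by positivity)

/-! #### Continuity in the base point -/

theorem continuous_gradExt_coe (hu : IsC2 u) : Continuous fun q : Sph n => gradExt u q :=
  continuous_iff_continuousAt.2 fun q =>
    (hu.continuousAt_gradExt (coe_ne_zero q)).comp continuous_subtype_val.continuousAt

theorem IsC2.continuous (hu : IsC2 u) : Continuous u := by
  have h : u = fun q : Sph n => radialExt u q := funext fun q => (radialExt_apply_coe u q).symm
  rw [h]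
  exact continuous_iff_continuousAt.2 fun q =>
    (hu.differentiableAt (coe_ne_zero q)).continuousAt.comp continuous_subtype_val.continuousAt

theorem continuous_slope (hu : IsC2 u) (hs : ∀ q, 0 < Real.sin (θ + u q)) :
    Continuous (slope θ u) := by
  have h1 := hu.continuous
  have h2 := continuous_gradExt_coe hu
  unfold slope
  simp_rw [Submodule.coe_norm, hu.coe_sphGrad]
  fun_prop (disch := exact fun q => pow_ne_zero 2 (hs q).ne')

/-- The extension by zero of an endomorphism of the tangent space. -/
def extendTan (A : Tan p →L[ℝ] Tan p) : Euc (n + 1) →L[ℝ] Euc (n + 1) :=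
  (Tan p).subtypeL.comp (A.comp (Tan p).orthogonalProjectionOnto)

theorem extendTan_add (A B : Tan p →L[ℝ] Tan p) :
    extendTan (A + B) = extendTan A + extendTan B := by ext1; simp [extendTan]

theorem extendTan_sub (A B : Tan p →L[ℝ] Tan p) :
    extendTan (A - B) = extendTan A - extendTan B := by ext1; simp [extendTan]

theorem extendTan_smul (c : ℝ) (A : Tan p →L[ℝ] Tan p) :
    extendTan (c • A) = c • extendTan A := by ext1; simp [extendTan]

theorem extendTan_mul (A B : Tan p →L[ℝ] Tan p) :
    extendTan (A * B) = extendTan A * extendTan B := by ext1; simp [extendTan]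

theorem extendTan_one :
    extendTan (1 : Tan p →L[ℝ] Tan p)
      = 1 - InnerProductSpace.rankOne ℝ (p : Euc (n + 1)) (p : Euc (n + 1)) := by
  ext1 v
  change (Tan p).starProjection v = _
  rw [Submodule.starProjection_orthogonal_val, Submodule.starProjection_unit_singleton ℝ (norm_coe p)]
  simp

theorem extendTan_gradSq (hu : IsC2 u) :
    extendTan (gradSq u p) = InnerProductSpace.rankOne ℝ (gradExt u p) (gradExt u p) := by
  ext1 v
  change ((gradSq u p ((Tan p).orthogonalProjectionOnto v) : Tan p) : Euc (n + 1)) = _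
  rw [gradSq, InnerProductSpace.rankOne_apply, Submodule.coe_smul,
    Submodule.inner_orthogonalProjectionOnto_eq_of_mem_left, hu.coe_sphGrad]
  rfl

/-- The identification of covectors with vectors given by the inner product. -/
def rieszInv (n : ℕ) : (Euc (n + 1) →L[ℝ] ℝ) →L[ℝ] Euc (n + 1) :=
  (InnerProductSpace.toDual ℝ (Euc (n + 1))).symm.toContinuousLinearEquiv.toContinuousLinearMap

/-- This form involves only maps of the fixed ambient space, so continuity in `p` can be read off.
-/
theorem extendTan_sphHess (hu : IsC2 u) :
    extendTan (sphHess u p) = extendTan (1 : Tan p →L[ℝ] Tan p) *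
      (rieszInv n).comp (hessExt u p) *
      extendTan (1 : Tan p →L[ℝ] Tan p) := by
  ext1 v
  refine ext_inner_right ℝ fun w => ?_
  change ⟪((sphHess u p ((Tan p).orthogonalProjectionOnto v) : Tan p) : Euc (n + 1)), w⟫
    = ⟪(Tan p).starProjection ((InnerProductSpace.toDual ℝ (Euc (n + 1))).symm
      (hessExt u p ((Tan p).orthogonalProjectionOnto v))), w⟫
  rw [Submodule.inner_starProjection_left_eq_right, InnerProductSpace.toDual_symm_apply,
    ← Submodule.inner_orthogonalProjectionOnto_eq_of_mem_left, hu.inner_sphHess]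
  rfl

theorem continuous_extendTan_weingarten (hu : IsC2 u) (hs : ∀ q, 0 < Real.sin (θ + u q)) :
    Continuous fun q : Sph n => extendTan (weingarten θ u q) := by
  simp_rw [weingarten_eq hu hs, metricInv, extendTan_mul, extendTan_smul, extendTan_add,
    extendTan_sub, extendTan_smul, extendTan_sphHess hu, extendTan_gradSq hu, extendTan_one]
  have h1 := hu.continuous
  have h2 := continuous_gradExt_coe hu
  have h3 := continuous_slope hu hs
  have h4 : Continuous fun q : Sph n => hessExt u q := continuous_iff_continuousAt.2 fun q =>
    (hu.continuousAt_hessExt (coe_ne_zero q)).comp continuous_subtype_val.continuousAt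
  have hr : ∀ {f : Sph n → Euc (n + 1)}, Continuous f →
      Continuous fun q => InnerProductSpace.rankOne ℝ (f q) (f q) := fun hf =>
    ((InnerProductSpace.rankOne ℝ).continuous.comp hf).clm_apply hf
  have h5 := hr h2
  have h6 := hr (continuous_subtype_val : Continuous fun q : Sph n => (q : Euc (n + 1)))
  have h7 : ∀ q, slope θ u q ≠ 0 := fun q => (slope_pos θ u q).ne'
  have h8 : ∀ q, Real.sin (θ + u q) ≠ 0 := fun q => (hs q).ne'
  have h9 : Continuous fun q => Real.cot (θ + u q) := by
    simp_rw [Real.cot_eq_cos_div_sin]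
    fun_prop (disch := exact h8)
  fun_prop (disch := first | exact h7 | exact fun q => pow_ne_zero 2 (h8 q) |
    exact fun q => mul_ne_zero (pow_ne_zero 2 (h8 q)) (pow_ne_zero 2 (h7 q)))

theorem continuous_principalCurvatures (hu : IsC2 u) (hs : ∀ q, 0 < Real.sin (θ + u q)) :
    Continuous (principalCurvatures θ u) :=
  continuous_iff_continuousAt.2 fun _ =>
    continuousAt_sortedEigs finrank_tan (fun _ => splits_charpoly_weingarten hu hs)
      (continuous_extendTan_weingarten hu hs).continuousAt

end Weingarten

/-! ### The integral of the Laplacian over the sphere -/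

section Divergence

variable {n : ℕ}

instance : IsFiniteMeasure (surfaceMeasure n) := by unfold surfaceMeasure; infer_instance

/-- Polar coordinates: the origin is a null set and the integrand is a product of an angular and a
radial function. -/
theorem integral_radialExt_mul (f : Sph n → ℝ) (h : ℝ → ℝ) :
    ∫ x, radialExt f x * h ‖x‖ = (∫ p, f p ∂surfaceMeasure n)
      * ∫ r : Set.Ioi (0 : ℝ), h r ∂Measure.volumeIoiPow (Module.finrank ℝ (Euc (n + 1)) - 1) := by
  have hx : ∀ x : ({0}ᶜ : Set (Euc (n + 1))), radialExt f (x : Euc (n + 1)) * h ‖(x : Euc (n + 1))‖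
      = (fun z : Sph n × Set.Ioi (0 : ℝ) => f z.1 * h z.2)
        (homeomorphUnitSphereProd (Euc (n + 1)) x) := fun x => by
    have hx : (x : Euc (n + 1)) ≠ 0 := x.2
    rw [radialExt_of_ne f hx]
    have h1 : toSph (x : Euc (n + 1)) hx = (homeomorphUnitSphereProd (Euc (n + 1)) x).1 := by
      ext1; simp [toSph]
    rw [h1]
    simp
  calc ∫ x, radialExt f x * h ‖x‖
      = ∫ x : ({0}ᶜ : Set (Euc (n + 1))), radialExt f (x : Euc (n + 1)) * h ‖(x : Euc (n + 1))‖
          ∂((volume : Measure (Euc (n + 1))).comap (↑)) := by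
        rw [integral_subtype_comap (measurableSet_singleton _).compl
          fun x => radialExt f x * h ‖x‖, restrict_compl_singleton]
    _ = ∫ z : Sph n × Set.Ioi (0 : ℝ), f z.1 * h z.2 ∂((surfaceMeasure n).prod
          (Measure.volumeIoiPow (Module.finrank ℝ (Euc (n + 1)) - 1))) := by
        rw [integral_congr_ae (Eventually.of_forall hx)]
        exact (volume : Measure (Euc (n + 1))).measurePreserving_homeomorphUnitSphereProd.integral_comp
          (Homeomorph.measurableEmbedding _) fun z : Sph n × Set.Ioi (0 : ℝ) => f z.1 * h z.2
    _ = _ := integral_prod_mul f fun r : Set.Ioi (0 : ℝ) => h r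

theorem integral_fderiv_eq_zero {f : Euc (n + 1) → ℝ} (hf : ContDiff ℝ 1 f)
    (hc : HasCompactSupport f) (v : Euc (n + 1)) : ∫ x, fderiv ℝ f x v = 0 := by
  have hf' : Continuous fun x => fderiv ℝ f x v :=
    (hf.continuous_fderiv one_ne_zero).clm_apply continuous_const
  have h := integral_mul_fderiv_eq_neg_fderiv_mul_of_integrable (μ := volume)
    (f := fun _ : Euc (n + 1) => (1 : ℝ)) (g := f) (v := v) (by simp)
    (by simpa using hf'.integrable_of_hasCompactSupport (hc.fderiv_apply ℝ v))
    (by simpa using hf.continuous.integrable_of_hasCompactSupport hc)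
    (fun x _ => differentiableAt_const _) (fun x _ => hf.differentiable one_ne_zero x)
  simpa using h

theorem fderiv_radialExt_smul (w : Sph n → ℝ) {r : ℝ} (hr : 0 < r) (x : Euc (n + 1)) :
    fderiv ℝ (radialExt w) x = r • fderiv ℝ (radialExt w) (r • x) := by
  rw [← fderiv_comp_smul]
  simp_rw [radialExt_smul w hr]

theorem hessExt_smul (w : Sph n → ℝ) {r : ℝ} (hr : 0 < r) (x : Euc (n + 1)) :
    hessExt w x = r ^ 2 • hessExt w (r • x) := by
  have h : fderiv ℝ (radialExt w) = fun x => r • fderiv ℝ (radialExt w) (r • x) :=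
    funext fun x => fderiv_radialExt_smul w hr x
  rw [hessExt, pow_two, mul_smul, hessExt, ← fderiv_comp_smul]
  conv_lhs => rw [h]
  exact congrFun (fderiv_const_smul_field (𝕜 := ℝ)
    (f := fun x => fderiv ℝ (radialExt w) (r • x)) r) x

/-- A smooth cutoff function of `‖x‖²`, supported in an annulus. -/
def cutoff : ContDiffBump (2 : ℝ) := ⟨1 / 2, 1, by norm_num, by norm_num⟩

theorem cutoff_eq_zero {x : Euc (n + 1)} (hx : ‖x‖ < 1) :
    (fun y : Euc (n + 1) => cutoff (‖y‖ ^ 2)) =ᶠ[𝓝 x] fun _ => 0 := by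
  filter_upwards [continuous_norm.continuousAt.eventually_lt_const hx] with y hy
  refine cutoff.zero_of_le_dist ?_
  rw [Real.dist_eq, abs_of_neg (by nlinarith [norm_nonneg y])]
  change (1 : ℝ) ≤ _
  nlinarith [norm_nonneg y]

theorem hasCompactSupport_cutoff :
    HasCompactSupport fun y : Euc (n + 1) => cutoff (‖y‖ ^ 2) := by
  refine HasCompactSupport.of_support_subset_isCompact
    (isCompact_closedBall (0 : Euc (n + 1)) 2) fun y hy => ?_
  rw [mem_closedBall_zero_iff]
  by_contra! hlt
  refine hy (cutoff.zero_of_le_dist ?_)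
  rw [Real.dist_eq, abs_of_pos (by nlinarith)]
  change (1 : ℝ) ≤ _
  nlinarith

theorem contDiff_cutoff : ContDiff ℝ 1 fun y : Euc (n + 1) => cutoff (‖y‖ ^ 2) :=
  cutoff.contDiff.comp (contDiff_norm_sq ℝ)

/-- This is the radial factor that `integral_sphLaplacian` cancels. Polar coordinates with f = 1
reduce it to the positivity of a Euclidean integral. -/
theorem integral_cutoff_ne_zero :
    ∫ r : Set.Ioi (0 : ℝ), cutoff ((r : ℝ) ^ 2) * ((r : ℝ) ^ 2)⁻¹
      ∂Measure.volumeIoiPow (Module.finrank ℝ (Euc (n + 1)) - 1) ≠ 0 := by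
  have h := integral_radialExt_mul (n := n) (fun _ => 1) fun r => cutoff (r ^ 2) * (r ^ 2)⁻¹
  have hpos : 0 < ∫ x : Euc (n + 1), cutoff (‖x‖ ^ 2) * (‖x‖ ^ 2)⁻¹ := by
    refine Continuous.integral_pos_of_hasCompactSupport_nonneg_nonzero
      -- Its squared norm is 2, the centre of the bump.
      (x := EuclideanSpace.single 0 (Real.sqrt 2)) ?_ hasCompactSupport_cutoff.mul_right ?_ ?_
    · refine continuous_iff_continuousAt.2 fun x => ?_
      by_cases hx : x = 0
      · refine (continuousAt_const (y := (0 : ℝ))).congr ?_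
        filter_upwards [cutoff_eq_zero (n := n) (x := x) (by simp [hx])] with y hy
        rw [hy, zero_mul]
      · exact contDiff_cutoff.continuous.continuousAt.mul ((continuousAt_id.norm.pow 2).inv₀
          (pow_ne_zero 2 (norm_ne_zero_iff.2 hx)))
    · exact fun x => mul_nonneg cutoff.nonneg (by positivity)
    · have h2 : ‖(EuclideanSpace.single 0 (Real.sqrt 2) : Euc (n + 1))‖ ^ 2 = 2 := by simp
      rw [h2, cutoff.one_of_mem_closedBall (by simp [cutoff])]
      norm_num
  intro h0
  rw [h0, mul_zero] at h
  refine hpos.ne' (Eq.trans ?_ h)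
  refine integral_congr_ae ?_
  filter_upwards [compl_mem_ae_iff.2 (measure_singleton (0 : Euc (n + 1)))] with x hx
  rw [radialExt_of_ne _ hx, one_mul]

/-- The compactly supported field χ(‖x‖²)∇w̄, with w̄ the radial extension and χ the cutoff, has
divergence of integral zero. As ∇w̄ ⟂ x, the derivative of χ drops out and the divergence is χ‖x‖⁻²
times the spherical Laplacian at x/‖x‖. Polar coordinates split off the nonzero radial factor. -/
theorem integral_sphLaplacian {w : Sph n → ℝ} (hw : IsC2 w) :
    ∫ p, sphLaplacian w p ∂surfaceMeasure n = 0 := by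
  let b := EuclideanSpace.basisFun (Fin (n + 1)) ℝ
  let f := fun (i : Fin (n + 1)) (x : Euc (n + 1)) =>
    cutoff (‖x‖ ^ 2) * fderiv ℝ (radialExt w) x (b i)
  have hf0 : ∀ i (x : Euc (n + 1)), ‖x‖ < 1 → f i =ᶠ[𝓝 x] fun _ => 0 := fun i x hx => by
    filter_upwards [cutoff_eq_zero hx] with y hy
    simp only [f, hy, zero_mul]
  have hf : ∀ i, ContDiff ℝ 1 (f i) := fun i => contDiff_iff_contDiffAt.2 fun x => by
    by_cases hx : x = 0
    · exact contDiffAt_const.congr_of_eventuallyEq (hf0 i x (by simp [hx]))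
    · exact contDiff_cutoff.contDiffAt.mul ((hw.contDiffAt_fderiv hx).clm_apply contDiffAt_const)
  have hfc : ∀ i, HasCompactSupport (f i) := fun i => hasCompactSupport_cutoff.mul_right
  have hderiv : ∀ x, ∑ i, fderiv ℝ (f i) x (b i)
      = radialExt (sphLaplacian w) x * (cutoff (‖x‖ ^ 2) * (‖x‖ ^ 2)⁻¹) := fun x => by
    by_cases hx : x = 0
    · have h1 : ∀ i, fderiv ℝ (f i) x = 0 := fun i => by
        rw [(hf0 i x (by simp [hx])).fderiv_eq]; simp
      simp only [h1, zero_apply, Finset.sum_const_zero]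
      simp [hx, radialExt]
    · have hx' : ‖x‖ ≠ 0 := norm_ne_zero_iff.2 hx
      have hc : HasFDerivAt (fun y : Euc (n + 1) => cutoff (‖y‖ ^ 2))
          (deriv cutoff (‖x‖ ^ 2) • (2 • innerSL ℝ x)) x :=
        HasDerivAt.comp_hasFDerivAt (f := fun y : Euc (n + 1) => ‖y‖ ^ 2) x
          (cutoff.contDiff (n := 1) |>.differentiable one_ne_zero _).hasDerivAt
          (hasStrictFDerivAt_norm_sq x).hasFDerivAt
      have h1 : ∀ i, fderiv ℝ (f i) x (b i) = cutoff (‖x‖ ^ 2) * hessExt w x (b i) (b i)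
          + 2 * deriv cutoff (‖x‖ ^ 2) * (⟪x, b i⟫ * ⟪b i, gradExt w x⟫) := fun i => by
        have := (hc.mul ((hw.hasFDerivAt_fderiv hx).clm_apply (hasFDerivAt_const (b i) x))).fderiv
        rw [show fderiv ℝ (f i) x = _ from this, real_inner_comm (gradExt w x), inner_gradExt]
        simp
        ring
      have h2 : ⟪x, gradExt w x⟫ = 0 := by
        rw [real_inner_comm, inner_gradExt, hw.fderiv_self hx]
      simp_rw [h1]
      rw [Finset.sum_add_distrib, ← Finset.mul_sum, ← Finset.mul_sum, b.sum_inner_mul_inner, h2,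
        mul_zero, add_zero, radialExt_of_ne _ hx, hw.sphLaplacian_eq_sum _ b]
      have h3 : ((toSph x hx : Sph n) : Euc (n + 1)) = ‖x‖⁻¹ • x := rfl
      have h4 := hessExt_smul w (inv_pos.2 (norm_pos_iff.2 hx)) x
      rw [h3, h4]
      simp only [smul_apply, smul_eq_mul, ← Finset.mul_sum]
      rw [inv_pow]
      ring
  have hsum : ∫ x, ∑ i, fderiv ℝ (f i) x (b i) = 0 := by
    rw [integral_finsetSum]
    · exact Finset.sum_eq_zero fun i _ => integral_fderiv_eq_zero (hf i) (hfc i) _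
    · intro i _
      exact (((hf i).continuous_fderiv one_ne_zero).clm_apply
        continuous_const).integrable_of_hasCompactSupport ((hfc i).fderiv_apply ℝ _)
  simp_rw [hderiv] at hsum
  rw [integral_radialExt_mul (sphLaplacian w) fun r => cutoff (r ^ 2) * (r ^ 2)⁻¹] at hsum
  exact (mul_eq_zero.1 hsum).resolve_right integral_cutoff_ne_zero

end Divergence

/-! ### First order expansion, uniform in the base point -/

section Expansion

open Asymptotics

variable {n k : ℕ} {θ : ℝ}

/-- The filter of pairs `(u, p)` with `u → 0` in `C^k`, uniformly in `p`. -/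
def unifNhds (n k : ℕ) : Filter (CkSph n k × Sph n) := 𝓝 0 ×ˢ 𝓟 Set.univ

theorem eventually_unifNhds {P : CkSph n k × Sph n → Prop} :
    (∀ᶠ z in unifNhds n k, P z) ↔ ∀ᶠ u in 𝓝 (0 : CkSph n k), ∀ p, P (u, p) := by
  rw [unifNhds, eventually_prod_principal_iff]
  simp

theorem tendsto_fst_unifNhds : Tendsto Prod.fst (unifNhds n k) (𝓝 0) := tendsto_fst

theorem tendsto_norm_unifNhds : Tendsto (fun z : CkSph n k × Sph n => ‖z.1‖) (unifNhds n k) (𝓝 0) := by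
  simpa using (tendsto_fst_unifNhds (n := n) (k := k)).norm

theorem isBigO_apply :
    (fun z : CkSph n k × Sph n => z.1 z.2) =O[unifNhds n k] fun z => ‖z.1‖ :=
  IsBigO.of_bound 1 <| Eventually.of_forall fun z => by
    simpa using abs_apply_le z.1 z.2

theorem tendsto_apply :
    Tendsto (fun z : CkSph n k × Sph n => z.1 z.2) (unifNhds n k) (𝓝 0) :=
  isBigO_apply.trans_tendsto tendsto_norm_unifNhds

theorem tendsto_const_add_apply :
    Tendsto (fun z : CkSph n k × Sph n => θ + z.1 z.2) (unifNhds n k) (𝓝 θ) := by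
  simpa using tendsto_apply.const_add θ

theorem tendsto_sin :
    Tendsto (fun z : CkSph n k × Sph n => Real.sin (θ + z.1 z.2)) (unifNhds n k)
      (𝓝 (Real.sin θ)) :=
  (Real.continuous_sin.tendsto θ).comp tendsto_const_add_apply

theorem eventually_sin_pos (hθ : 0 < Real.sin θ) :
    ∀ᶠ u in 𝓝 (0 : CkSph n k), ∀ p, 0 < Real.sin (θ + u p) :=
  eventually_unifNhds.1 (tendsto_sin.eventually_const_lt hθ)

theorem hasDerivAt_cot {x : ℝ} (hx : Real.sin x ≠ 0) :
    HasDerivAt Real.cot (-(Real.sin x ^ 2)⁻¹) x := by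
  have h1 : Real.cot = fun y => Real.cos y / Real.sin y := funext Real.cot_eq_cos_div_sin
  rw [h1]
  convert! (Real.hasDerivAt_cos x).div (Real.hasDerivAt_sin x) hx using 1
  field_simp
  linarith [Real.sin_sq_add_cos_sq x]

theorem tendsto_cot (hθ : 0 < Real.sin θ) :
    Tendsto (fun z : CkSph n k × Sph n => Real.cot (θ + z.1 z.2)) (unifNhds n k)
      (𝓝 (Real.cot θ)) :=
  (hasDerivAt_cot hθ.ne').continuousAt.tendsto.comp tendsto_const_add_apply

theorem isLittleO_norm_sq :
    (fun z : CkSph n k × Sph n => ‖z.1‖ ^ 2) =o[unifNhds n k] fun z => ‖z.1‖ :=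
  (isLittleO_pow_id one_lt_two).comp_tendsto tendsto_norm_unifNhds

theorem isBigO_norm_sphGrad_sq (hk : 2 ≤ k) :
    (fun z : CkSph n k × Sph n => ‖sphGrad z.1 z.2‖ ^ 2) =O[unifNhds n k] fun z => ‖z.1‖ ^ 2 :=
  IsBigO.of_bound 1 <| Eventually.of_forall fun z => by
    rw [one_mul, norm_pow, norm_pow, norm_norm, norm_norm]
    exact pow_le_pow_left₀ (norm_nonneg _) (norm_sphGrad_le z.1 hk z.2) 2

theorem isBigO_norm_sphHess (hk : 2 ≤ k) :
    (fun z : CkSph n k × Sph n => ‖sphHess z.1 z.2‖) =O[unifNhds n k] fun z => ‖z.1‖ :=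
  IsBigO.of_bound 1 <| Eventually.of_forall fun z => by
    rw [one_mul, norm_norm, Real.norm_of_nonneg (norm_nonneg (sphHess z.1 z.2))]
    exact norm_sphHess_le z.1 hk z.2

theorem one_le_slope (θ : ℝ) (u : Sph n → ℝ) (p : Sph n) : 1 ≤ slope θ u p :=
  Real.one_le_sqrt.2 (le_add_of_nonneg_right (by positivity))

/-- Since W ≥ 1, W − 1 ≤ W² − 1 = ‖ξ‖²/sin², which is quadratic in `u`. -/
theorem isBigO_slope_sub_one (hk : 2 ≤ k) (hθ : 0 < Real.sin θ) :
    (fun z : CkSph n k × Sph n => slope θ z.1 z.2 - 1) =O[unifNhds n k] fun z => ‖z.1‖ ^ 2 := by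
  have h1 : (fun z : CkSph n k × Sph n => ‖sphGrad z.1 z.2‖ ^ 2 * (Real.sin (θ + z.1 z.2) ^ 2)⁻¹)
      =O[unifNhds n k] fun z => ‖z.1‖ ^ 2 * (1 : ℝ) :=
    (isBigO_norm_sphGrad_sq hk).mul
      (((tendsto_sin (θ := θ)).pow 2).inv₀ (pow_ne_zero 2 hθ.ne') |>.isBigO_one ℝ)
  simp_rw [mul_one] at h1
  refine IsBigO.trans (IsBigO.of_bound 1 <| Eventually.of_forall fun z => ?_) h1
  have hW := one_le_slope θ z.1 z.2
  have hW2 := slope_sq θ z.1 z.2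
  rw [div_eq_mul_inv] at hW2
  rw [one_mul, Real.norm_eq_abs, abs_of_nonneg (by linarith),
    Real.norm_eq_abs, abs_of_nonneg (by positivity)]
  nlinarith

theorem tendsto_slope (hk : 2 ≤ k) (hθ : 0 < Real.sin θ) :
    Tendsto (fun z : CkSph n k × Sph n => slope θ z.1 z.2) (unifNhds n k) (𝓝 1) := by
  have h := (isBigO_slope_sub_one hk hθ).trans_tendsto
    (isLittleO_norm_sq.trans_tendsto (tendsto_norm_unifNhds (n := n) (k := k)))
  simpa using h.add_const 1

theorem isBigO_slope_inv_sub_one (hk : 2 ≤ k) (hθ : 0 < Real.sin θ) :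
    (fun z : CkSph n k × Sph n => (slope θ z.1 z.2)⁻¹ - 1) =O[unifNhds n k]
      fun z => ‖z.1‖ ^ 2 := by
  refine IsBigO.trans (IsBigO.of_bound 1 <| Eventually.of_forall fun z => ?_)
    (isBigO_slope_sub_one hk hθ)
  have hW := one_le_slope θ z.1 z.2
  have h1 : (slope θ z.1 z.2)⁻¹ - 1 = -((slope θ z.1 z.2 - 1) * (slope θ z.1 z.2)⁻¹) := by
    field_simp; ring
  rw [h1, norm_neg, norm_mul, mul_comm, norm_inv]
  refine mul_le_mul_of_nonneg_right ?_ (norm_nonneg _)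
  rw [Real.norm_eq_abs, abs_of_pos (by linarith)]
  exact inv_le_one_of_one_le₀ hW

theorem norm_gradSq (u : Sph n → ℝ) (p : Sph n) : ‖gradSq u p‖ = ‖sphGrad u p‖ ^ 2 := by
  rw [gradSq, InnerProductSpace.norm_rankOne, sq]

/-- The deviation of the Weingarten map from its first order expansion in `u`. -/
def weingartenError (θ : ℝ) (u : Sph n → ℝ) (p : Sph n) : Tan p →L[ℝ] Tan p :=
  weingarten θ u p - Real.cot θ • (1 : Tan p →L[ℝ] Tan p)
    + (Real.sin θ ^ 2)⁻¹ • (u p • (1 : Tan p →L[ℝ] Tan p) + sphHess u p)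

/-- Sorts the error of g⁻¹h by order, with Q = ξ⊗ξ and H = Hess u: the coefficient of 1 will be
o(‖u‖), that of H tends to 0, and all other terms contain the quadratic Q. -/
theorem rankOne_perturbation_expansion {R : Type*} [Ring R] [Algebra ℝ R]
    (s e w d g c b t : ℝ) (Q H : R) :
    (s • ((1 : R) - e • Q)) * (w • (d • (1 : R) - H + g • Q)) - c • (1 : R) + b • (t • (1 : R) + H)
      = (s * w * d - c + b * t) • (1 : R) + (b - s * w) • H + (s * w * g) • Q
        - (s * e * w) • (Q * (d • (1 : R) - H + g • Q)) := by
  simp only [smul_mul_assoc, mul_smul_comm, sub_mul, one_mul]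
  module

theorem norm_combination_le {M : Type*} [NormedAddCommGroup M] [NormedSpace ℝ M]
    (a b c d e g : ℝ) (Q H : M →L[ℝ] M) :
    ‖a • (1 : M →L[ℝ] M) + b • H + c • Q - d • (Q * (e • (1 : M →L[ℝ] M) - H + g • Q))‖
      ≤ |a| + |b| * ‖H‖ + |c| * ‖Q‖ + |d| * (‖Q‖ * (|e| + ‖H‖ + |g| * ‖Q‖)) := by
  have h1 : ‖(1 : M →L[ℝ] M)‖ ≤ 1 := ContinuousLinearMap.norm_id_le
  have hone : ∀ x : ℝ, ‖x • (1 : M →L[ℝ] M)‖ ≤ |x| := fun x => by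
    rw [norm_smul, Real.norm_eq_abs]
    exact mul_le_of_le_one_right (abs_nonneg x) h1
  have hsm : ∀ (x : ℝ) (A : M →L[ℝ] M), ‖x • A‖ = |x| * ‖A‖ := fun x A => by
    rw [norm_smul, Real.norm_eq_abs]
  have hK : ‖e • (1 : M →L[ℝ] M) - H + g • Q‖ ≤ |e| + ‖H‖ + |g| * ‖Q‖ := by
    refine (norm_add_le _ _).trans ?_
    rw [hsm]
    have := norm_sub_le (e • (1 : M →L[ℝ] M)) H
    linarith [hone e]
  refine (norm_sub_le _ _).trans ?_
  have h2 := norm_add₃_le (a := a • (1 : M →L[ℝ] M)) (b := b • H) (c := c • Q)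
  rw [hsm b, hsm c] at h2
  have h3 : ‖d • (Q * (e • (1 : M →L[ℝ] M) - H + g • Q))‖
      ≤ |d| * (‖Q‖ * (|e| + ‖H‖ + |g| * ‖Q‖)) := by
    rw [hsm]
    gcongr
    refine (ContinuousLinearMap.opNorm_comp_le Q _).trans ?_
    gcongr
  linarith [hone a]

theorem norm_sub_smul_smul_one_add_le {M : Type*} [NormedAddCommGroup M] [NormedSpace ℝ M]
    (E H : M →L[ℝ] M) (b t : ℝ) :
    ‖E - b • (t • (1 : M →L[ℝ] M) + H)‖ ≤ ‖E‖ + |b| * (|t| + ‖H‖) := by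
  refine (norm_sub_le _ _).trans ?_
  rw [norm_smul, Real.norm_eq_abs]
  gcongr
  refine (norm_add_le _ _).trans ?_
  gcongr
  rw [norm_smul, Real.norm_eq_abs]
  exact mul_le_of_le_one_right (abs_nonneg t) ContinuousLinearMap.norm_id_le

theorem isLittleO_weingartenError (hk : 2 ≤ k) (hθ : 0 < Real.sin θ) :
    (fun z : CkSph n k × Sph n => ‖weingartenError θ z.1 z.2‖) =o[unifNhds n k]
      fun z => ‖z.1‖ := by
  set l := unifNhds n k
  let N := fun z : CkSph n k × Sph n => ‖z.1‖
  let sn := fun z : CkSph n k × Sph n => (Real.sin (θ + z.1 z.2) ^ 2)⁻¹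
  let ct := fun z : CkSph n k × Sph n => Real.cot (θ + z.1 z.2)
  let W := fun z : CkSph n k × Sph n => slope θ z.1 z.2
  let Q := fun z : CkSph n k × Sph n => ‖sphGrad z.1 z.2‖ ^ 2
  let H := fun z : CkSph n k × Sph n => ‖sphHess z.1 z.2‖
  let d := fun z : CkSph n k × Sph n => Real.sin (θ + z.1 z.2) * Real.cos (θ + z.1 z.2)
  have hsn : Tendsto sn l (𝓝 (Real.sin θ ^ 2)⁻¹) := (tendsto_sin.pow 2).inv₀ (pow_ne_zero 2 hθ.ne')
  have hct : Tendsto ct l (𝓝 (Real.cot θ)) := tendsto_cot hθ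
  have hW : Tendsto W l (𝓝 1) := tendsto_slope hk hθ
  have hWi : Tendsto (fun z => (W z)⁻¹) l (𝓝 1) := by simpa using hW.inv₀ one_ne_zero
  have hd : Tendsto d l (𝓝 (Real.sin θ * Real.cos θ)) :=
    tendsto_sin.mul ((Real.continuous_cos.tendsto θ).comp tendsto_const_add_apply)
  have hN : Tendsto N l (𝓝 0) := tendsto_norm_unifNhds
  have hQ : Q =o[l] N := (isBigO_norm_sphGrad_sq hk).trans_isLittleO isLittleO_norm_sq
  have hH : H =O[l] N := isBigO_norm_sphHess hk
  let α := fun z : CkSph n k × Sph n => sn z * (W z)⁻¹ * d z - Real.cot θ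
    + (Real.sin θ ^ 2)⁻¹ * z.1 z.2
  have hα : α =o[l] N := by
    -- Because sin⁻²·sin·cos = cot, α splits into this quadratic part and the Taylor remainder of
    -- cot at θ.
    have h1 : (fun z => ((W z)⁻¹ - 1) * ct z) =o[l] N := by
      have := (isBigO_slope_inv_sub_one (n := n) hk hθ).mul (hct.isBigO_one ℝ)
      simp_rw [mul_one] at this
      exact this.trans_isLittleO isLittleO_norm_sq
    have h2 : (fun z : CkSph n k × Sph n => ct z - Real.cot θ + (Real.sin θ ^ 2)⁻¹ * z.1 z.2)
        =o[l] N := by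
      have h3 := ((hasDerivAt_cot hθ.ne').isLittleO.comp_tendsto
        (tendsto_const_add_apply (n := n) (k := k))).congr_right
        (g₂ := fun z : CkSph n k × Sph n => z.1 z.2) (fun z => by simp)
      refine (h3.trans_isBigO isBigO_apply).congr_left fun z => ?_
      simp [ct]
      ring
    refine (h1.add h2).congr' ?_ EventuallyEq.rfl
    filter_upwards [(tendsto_sin (θ := θ) (n := n) (k := k)).eventually_const_lt hθ] with z hz
    simp only [α, sn, ct, d, Real.cot_eq_cos_div_sin]
    field_simp
    ring
  have hβ : Tendsto (fun z => (Real.sin θ ^ 2)⁻¹ - sn z * (W z)⁻¹) l (𝓝 0) := by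
    have := (hsn.mul hWi).const_sub (Real.sin θ ^ 2)⁻¹
    rwa [mul_one, sub_self] at this
  have hγ : Tendsto (fun z => sn z * (W z)⁻¹ * (2 * ct z)) l
      (𝓝 ((Real.sin θ ^ 2)⁻¹ * 1 * (2 * Real.cot θ))) := (hsn.mul hWi).mul (hct.const_mul 2)
  have hδ : Tendsto (fun z => sn z * (Real.sin (θ + z.1 z.2) ^ 2 * W z ^ 2)⁻¹ * (W z)⁻¹) l
      (𝓝 ((Real.sin θ ^ 2)⁻¹ * (Real.sin θ ^ 2 * 1 ^ 2)⁻¹ * 1)) := by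
    refine (hsn.mul (((tendsto_sin.pow 2).mul (hW.pow 2)).inv₀ ?_)).mul hWi
    have := hθ.ne'
    positivity
  have hK : Tendsto (fun z => |d z| + H z + |2 * ct z| * Q z) l
      (𝓝 (|Real.sin θ * Real.cos θ| + 0 + |2 * Real.cot θ| * 0)) :=
    (hd.abs.add (hH.trans_tendsto hN)).add
      ((hct.const_mul 2).abs.mul (hQ.isBigO.trans_tendsto hN))
  have hfin : (fun z => |α z| + |(Real.sin θ ^ 2)⁻¹ - sn z * (W z)⁻¹| * H z
      + |sn z * (W z)⁻¹ * (2 * ct z)| * Q z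
      + |sn z * (Real.sin (θ + z.1 z.2) ^ 2 * W z ^ 2)⁻¹ * (W z)⁻¹|
        * (Q z * (|d z| + H z + |2 * ct z| * Q z))) =o[l] N := by
    refine ((hα.norm_left.add ?_).add ?_).add ?_
    · have := ((isLittleO_one_iff ℝ).2 hβ).norm_left.mul_isBigO hH
      simpa using this
    · have := (hγ.isBigO_one ℝ).norm_left.mul_isLittleO hQ
      simpa using this
    · have := (hδ.isBigO_one ℝ).norm_left.mul_isLittleO (hQ.mul_isBigO (hK.isBigO_one ℝ))
      simpa using this
  refine IsBigO.trans_isLittleO (IsBigO.of_bound 1 ?_) hfin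
  filter_upwards [tendsto_fst_unifNhds.eventually (eventually_sin_pos hθ)] with z hz
  rw [one_mul, Real.norm_of_nonneg (norm_nonneg (weingartenError θ z.1 z.2))]
  refine le_trans ?_ (Real.le_norm_self _)
  rw [weingartenError, weingarten_eq (isC2_coe z.1 hk) hz, metricInv,
    rankOne_perturbation_expansion]
  refine (norm_combination_le _ _ _ _ _ _ _ _).trans (le_of_eq ?_)
  rw [norm_gradSq]

theorem isBigO_weingarten_sub (hk : 2 ≤ k) (hθ : 0 < Real.sin θ) :
    (fun z : CkSph n k × Sph n => ‖weingarten θ z.1 z.2 - Real.cot θ • (1 : Tan z.2 →L[ℝ] Tan z.2)‖)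
      =O[unifNhds n k] fun z => ‖z.1‖ := by
  have h1 : (fun z : CkSph n k × Sph n => ‖weingartenError θ z.1 z.2‖
      + (Real.sin θ ^ 2)⁻¹ * (‖z.1 z.2‖ + ‖sphHess z.1 z.2‖)) =O[unifNhds n k] fun z => ‖z.1‖ :=
    (isLittleO_weingartenError hk hθ).isBigO.add
      ((isBigO_apply.norm_left.add (isBigO_norm_sphHess hk)).const_mul_left _)
  refine IsBigO.trans (IsBigO.of_bound 1 <| Eventually.of_forall fun z => ?_) h1
  rw [one_mul, Real.norm_of_nonneg (norm_nonneg
    (weingarten θ z.1 z.2 - Real.cot θ • (1 : Tan z.2 →L[ℝ] Tan z.2)))]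
  refine le_trans ?_ (Real.le_norm_self _)
  have h2 : weingarten θ z.1 z.2 - Real.cot θ • (1 : Tan z.2 →L[ℝ] Tan z.2)
      = weingartenError θ z.1 z.2 - (Real.sin θ ^ 2)⁻¹
        • (z.1 z.2 • (1 : Tan z.2 →L[ℝ] Tan z.2) + sphHess z.1 z.2) := by
    rw [weingartenError]; abel
  rw [h2]
  refine (norm_sub_smul_smul_one_add_le _ _ _ _).trans (le_of_eq ?_)
  rw [abs_of_pos (by positivity), Real.norm_eq_abs]

theorem isBigO_principalCurvatures_sub (hk : 2 ≤ k) (hθ : 0 < Real.sin θ) :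
    (fun z : CkSph n k × Sph n => principalCurvatures θ z.1 z.2 - fun _ => Real.cot θ)
      =O[unifNhds n k] fun z => ‖z.1‖ := by
  refine IsBigO.trans (IsBigO.of_bound 1 ?_) (isBigO_weingarten_sub hk hθ)
  filter_upwards [tendsto_fst_unifNhds.eventually (eventually_sin_pos hθ)] with z hz
  rw [one_mul, Real.norm_of_nonneg (norm_nonneg
    (weingarten θ z.1 z.2 - Real.cot θ • (1 : Tan z.2 →L[ℝ] Tan z.2)))]
  exact norm_principalCurvatures_sub_le (isC2_coe z.1 hk) hz _

/-- All principal curvatures of the geodesic sphere of radius `θ` are `cot θ`. -/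
theorem principalCurvatures_zero (hθ : 0 < Real.sin θ) (p : Sph n) :
    principalCurvatures θ (0 : Sph n → ℝ) p = fun _ => Real.cot θ := by
  -- A bound C‖u‖ valid near 0 holds at u = 0 itself, where it forces equality.
  obtain ⟨C, hC⟩ := (isBigO_principalCurvatures_sub (n := n) (k := 2) le_rfl hθ).bound
  have h := (eventually_unifNhds.1 hC).self_of_nhds p
  rw [norm_norm, norm_zero, mul_zero, norm_le_zero_iff, sub_eq_zero] at h
  exact h

/-- The stability operator `Δ + n` of the sphere. -/
def jacobi (w : Sph n → ℝ) (p : Sph n) : ℝ := sphLaplacian w p + n * w p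

/-- The left side is the trace of `weingartenError`, at most `n` times its norm. -/
theorem isLittleO_sum_principalCurvatures (hk : 2 ≤ k) (hθ : 0 < Real.sin θ) :
    (fun z : CkSph n k × Sph n => ∑ i, (principalCurvatures θ z.1 z.2 i - Real.cot θ)
      + (Real.sin θ ^ 2)⁻¹ * jacobi z.1 z.2) =o[unifNhds n k] fun z => ‖z.1‖ := by
  refine IsBigO.trans_isLittleO (IsBigO.of_bound n ?_) (isLittleO_weingartenError hk hθ)
  filter_upwards [tendsto_fst_unifNhds.eventually (eventually_sin_pos hθ)] with z hz
  have h := abs_trace_le (finrank_tan z.2) (weingartenError θ z.1 z.2)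
  rw [Real.norm_of_nonneg (norm_nonneg (weingartenError θ z.1 z.2)), Real.norm_eq_abs]
  convert! h using 2
  have h1 : ((weingartenError θ z.1 z.2 : Tan z.2 →L[ℝ] Tan z.2) : Tan z.2 →ₗ[ℝ] Tan z.2)
      = (weingarten θ z.1 z.2 : Tan z.2 →ₗ[ℝ] Tan z.2) - Real.cot θ • (1 : Module.End ℝ (Tan z.2))
        + (Real.sin θ ^ 2)⁻¹ • (z.1 z.2 • (1 : Module.End ℝ (Tan z.2))
          + (sphHess z.1 z.2 : Tan z.2 →ₗ[ℝ] Tan z.2)) := rfl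
  rw [h1, map_add, map_sub, map_smul, map_smul, map_add, map_smul, LinearMap.trace_one,
    finrank_tan, ← sum_principalCurvatures (isC2_coe z.1 hk) hz, ← sphLaplacian_eq_trace,
    Finset.sum_sub_distrib, jacobi]
  simp
  ring

/-- Transpositions fix the diagonal point and preserve `F`, so all partial derivatives there agree.
-/
theorem fderiv_symmetric [NeZero n] {F : (Fin n → ℝ) → ℝ} {x : ℝ}
    (hF : DifferentiableAt ℝ F fun _ => x)
    (hFsymm : ∀ (σ : Equiv.Perm (Fin n)) (x : Fin n → ℝ), F (x ∘ σ) = F x) (v : Fin n → ℝ) :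
    fderiv ℝ F (fun _ => x) v = fderiv ℝ F (fun _ => x) (Pi.single 0 1) * ∑ i, v i := by
  have h1 : ∀ i, fderiv ℝ F (fun _ => x) (Pi.single i 1)
      = fderiv ℝ F (fun _ => x) (Pi.single 0 1) := fun i => by
    let e : (Fin n → ℝ) →L[ℝ] (Fin n → ℝ) :=
      ContinuousLinearMap.pi fun j => ContinuousLinearMap.proj (Equiv.swap 0 i j)
    have he : ∀ y, e y = y ∘ Equiv.swap 0 i := fun y => rfl
    have h2 : HasFDerivAt (F ∘ e) ((fderiv ℝ F fun _ => x).comp e) (fun _ => x) := by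
      refine HasFDerivAt.comp _ ?_ e.hasFDerivAt
      exact hF.hasFDerivAt
    have h3 : F ∘ e = F := funext fun y => by rw [Function.comp_apply, he, hFsymm]
    rw [h3] at h2
    have h4 := congrArg (fun L : (Fin n → ℝ) →L[ℝ] ℝ => L (Pi.single 0 1)) h2.fderiv
    simp only [ContinuousLinearMap.comp_apply] at h4
    rw [h4]
    congr 1
    funext j
    rw [he, Function.comp_apply, Pi.single_apply, Pi.single_apply]
    congr 1
    rw [eq_iff_iff]
    constructor
    · rintro rfl; simp
    · intro h
      rw [Equiv.swap_apply_eq_iff, Equiv.swap_apply_left] at h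
      exact h
  have h6 := LinearMap.pi_apply_eq_sum_univ
    ((fderiv ℝ F fun _ => x : (Fin n → ℝ) →L[ℝ] ℝ) : (Fin n → ℝ) →ₗ[ℝ] ℝ) v
  simp only [ContinuousLinearMap.coe_coe] at h6
  rw [h6, Finset.mul_sum]
  refine Finset.sum_congr rfl fun i _ => ?_
  have h5 : (fun j => if i = j then (1 : ℝ) else 0) = Pi.single i 1 := by
    funext j; rw [Pi.single_apply]; simp [eq_comm]
  rw [h5, h1, smul_eq_mul, mul_comm]

theorem isLittleO_speedFunction [NeZero n] (hk : 2 ≤ k) (hθ : 0 < Real.sin θ)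
    {F : (Fin n → ℝ) → ℝ} (hF : DifferentiableAt ℝ F fun _ => Real.cot θ)
    (hFsymm : ∀ (σ : Equiv.Perm (Fin n)) (x : Fin n → ℝ), F (x ∘ σ) = F x) :
    (fun z : CkSph n k × Sph n => F (principalCurvatures θ z.1 z.2) - F (fun _ => Real.cot θ)
      + fderiv ℝ F (fun _ => Real.cot θ) (Pi.single 0 1) * (Real.sin θ ^ 2)⁻¹ * jacobi z.1 z.2)
      =o[unifNhds n k] fun z => ‖z.1‖ := by
  have h0 := isBigO_principalCurvatures_sub (n := n) hk hθ
  have ht : Tendsto (fun z : CkSph n k × Sph n => principalCurvatures θ z.1 z.2) (unifNhds n k)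
      (𝓝 fun _ => Real.cot θ) := by
    rw [← tendsto_sub_nhds_zero_iff]
    exact h0.trans_tendsto tendsto_norm_unifNhds
  have h1 := (hF.hasFDerivAt.isLittleO.comp_tendsto ht).trans_isBigO h0
  have h2 := (isLittleO_sum_principalCurvatures (n := n) hk hθ).const_mul_left
    (fderiv ℝ F (fun _ => Real.cot θ) (Pi.single 0 1))
  refine (h1.add h2).congr_left fun z => ?_
  have h3 := fderiv_symmetric hF hFsymm (principalCurvatures θ z.1 z.2 - fun _ => Real.cot θ)
  simp only [Pi.sub_apply] at h3
  simp only [Function.comp_apply, h3]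
  ring

end Expansion

/-! ### Averages over the graph and the linearised speed -/

section Average

open Asymptotics

variable {n k : ℕ} {θ : ℝ}

theorem surfaceMeasure_ne_zero : surfaceMeasure n ≠ 0 := by
  intro h
  have h1 := (volume : Measure (Euc (n + 1))).toSphere_real_apply_univ
  rw [show (volume : Measure (Euc (n + 1))).toSphere = 0 from h] at h1
  have h2 : 0 < (volume : Measure (Euc (n + 1))).real (Metric.ball 0 1) :=
    ENNReal.toReal_pos (Metric.measure_ball_pos _ _ one_pos).ne' measure_ball_lt_top.ne
  rw [measureReal_zero_apply, finrank_euclideanSpace_fin] at h1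
  have h3 : (0 : ℝ) < ((n + 1 : ℕ) : ℝ) := Nat.cast_pos.2 n.succ_pos
  exact (mul_pos h3 h2).ne h1

theorem surfaceMeasure_real_pos : 0 < (surfaceMeasure n).real Set.univ :=
  ENNReal.toReal_pos (by simpa using surfaceMeasure_ne_zero) (measure_ne_top _ _)

theorem integrable_of_continuous {μ : Measure (Sph n)} [IsFiniteMeasure μ] {f : Sph n → ℝ}
    (hf : Continuous f) : Integrable f μ :=
  hf.integrable_of_hasCompactSupport (HasCompactSupport.of_compactSpace f)

/-- The density of the area measure of the graph. -/
def density (θ : ℝ) (u : Sph n → ℝ) (p : Sph n) : ℝ := Real.sin (θ + u p) ^ n * slope θ u p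

theorem graphMeasure_eq {u : Sph n → ℝ} (hu : IsC2 u) (hs : ∀ q, 0 < Real.sin (θ + u q)) :
    graphMeasure θ u = (surfaceMeasure n).withDensity fun q => ENNReal.ofReal (density θ u q) := by
  simp_rw [graphMeasure, sqrt_det_inducedMetric hu (hs _), density]

theorem continuous_density {u : Sph n → ℝ} (hu : IsC2 u) (hs : ∀ q, 0 < Real.sin (θ + u q)) :
    Continuous (density θ u) := by
  have h1 := hu.continuous
  have h2 := continuous_slope hu hs
  unfold density
  fun_prop

theorem density_pos {u : Sph n → ℝ} {p : Sph n} (hs : 0 < Real.sin (θ + u p)) :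
    0 < density θ u p := mul_pos (pow_pos hs n) (slope_pos θ u p)

theorem isFiniteMeasure_graphMeasure {u : Sph n → ℝ} (hu : IsC2 u)
    (hs : ∀ q, 0 < Real.sin (θ + u q)) : IsFiniteMeasure (graphMeasure θ u) := by
  rw [graphMeasure_eq hu hs]
  exact isFiniteMeasure_withDensity_ofReal
    (integrable_of_continuous (continuous_density hu hs)).2

theorem integral_graphMeasure {u : Sph n → ℝ} (hu : IsC2 u) (hs : ∀ q, 0 < Real.sin (θ + u q))
    (f : Sph n → ℝ) :
    ∫ q, f q ∂graphMeasure θ u = ∫ q, f q * density θ u q ∂surfaceMeasure n := by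
  rw [graphMeasure_eq hu hs, integral_withDensity_eq_integral_toReal_smul
    (continuous_density hu hs).measurable.ennreal_ofReal (by simp)]
  refine integral_congr_ae (Eventually.of_forall fun q => ?_)
  simp only [smul_eq_mul]
  rw [ENNReal.toReal_ofReal (density_pos (hs q)).le, mul_comm]

theorem tendsto_density (hk : 2 ≤ k) (hθ : 0 < Real.sin θ) :
    Tendsto (fun z : CkSph n k × Sph n => density θ z.1 z.2) (unifNhds n k)
      (𝓝 (Real.sin θ ^ n)) := by
  simpa [density] using (tendsto_sin.pow n).mul (tendsto_slope hk hθ)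

/-- Integration over the sphere of a family that is small uniformly in the base point. -/
theorem isLittleO_integral {g : CkSph n k × Sph n → ℝ} {h : CkSph n k → ℝ}
    (hg : g =o[unifNhds n k] fun z => h z.1) :
    (fun u => ∫ p, g (u, p) ∂surfaceMeasure n) =o[𝓝 0] h := by
  rw [isLittleO_iff]
  intro ε hε
  have hM := surfaceMeasure_real_pos (n := n)
  have h1 := eventually_unifNhds.1 (isLittleO_iff.1 hg (div_pos hε hM))
  filter_upwards [h1] with u hu
  refine (norm_integral_le_of_norm_le_const (Eventually.of_forall hu)).trans (le_of_eq ?_)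
  field_simp

theorem isBigO_jacobi (hk : 2 ≤ k) :
    (fun z : CkSph n k × Sph n => jacobi z.1 z.2) =O[unifNhds n k] fun z => ‖z.1‖ := by
  refine IsBigO.add (IsBigO.trans (IsBigO.of_bound n <| Eventually.of_forall fun z => ?_)
    (isBigO_norm_sphHess hk)) (isBigO_apply.const_mul_left _)
  rw [Real.norm_of_nonneg (norm_nonneg (sphHess z.1 z.2))]
  exact abs_trace_le (finrank_tan z.2) _

theorem continuous_sphLaplacian {w : Sph n → ℝ} (hw : IsC2 w) : Continuous (sphLaplacian w) := by
  have h : sphLaplacian w = fun p : Sph n => ∑ i, hessExt w p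
      (EuclideanSpace.basisFun (Fin (n + 1)) ℝ i) (EuclideanSpace.basisFun (Fin (n + 1)) ℝ i) :=
    funext fun p => hw.sphLaplacian_eq_sum p _
  have h4 : Continuous fun q : Sph n => hessExt w q := continuous_iff_continuousAt.2 fun q =>
    (hw.continuousAt_hessExt (coe_ne_zero q)).comp continuous_subtype_val.continuousAt
  rw [h]
  fun_prop

theorem continuous_jacobi {w : Sph n → ℝ} (hw : IsC2 w) : Continuous (jacobi w) :=
  (continuous_sphLaplacian hw).add (continuous_const.mul hw.continuous)

/-- Linearity of the Laplacian on `C^k` is inherited from that of `jet`. -/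
theorem sphLaplacian_eq_jet (hk : 2 ≤ k) (w : CkSph n k) (p : Sph n) :
    sphLaplacian w p = ∑ i, jet n k w ⟨2, Nat.lt_succ_of_le hk⟩ p
      fun _ => EuclideanSpace.basisFun (Fin (n + 1)) ℝ i := by
  rw [(isC2_coe w hk).sphLaplacian_eq_sum p (EuclideanSpace.basisFun (Fin (n + 1)) ℝ)]
  refine Finset.sum_congr rfl fun i _ => ?_
  exact (iteratedFDeriv_two_apply (𝕜 := ℝ) (radialExt (w : Sph n → ℝ)) (p : Euc (n + 1))
    fun _ => EuclideanSpace.basisFun (Fin (n + 1)) ℝ i).symm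

theorem sphLaplacian_add (hk : 2 ≤ k) (v w : CkSph n k) (p : Sph n) :
    sphLaplacian (v + w : CkSph n k) p = sphLaplacian v p + sphLaplacian w p := by
  simp only [sphLaplacian_eq_jet hk, map_add]
  rw [← Finset.sum_add_distrib]
  rfl

theorem sphLaplacian_smul (hk : 2 ≤ k) (c : ℝ) (w : CkSph n k) (p : Sph n) :
    sphLaplacian (c • w : CkSph n k) p = c * sphLaplacian w p := by
  simp only [sphLaplacian_eq_jet hk, map_smul]
  rw [Finset.mul_sum]
  rfl

theorem continuous_coe (w : CkSph n k) : Continuous w := w.contMDiff.continuous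

theorem abs_average_le (w : CkSph n k) : |⨍ q, w q ∂surfaceMeasure n| ≤ ‖w‖ := by
  have hM := surfaceMeasure_real_pos (n := n)
  have h : ‖∫ q, w q ∂surfaceMeasure n‖ ≤ ‖w‖ * (surfaceMeasure n).real Set.univ :=
    norm_integral_le_of_norm_le_const (Eventually.of_forall fun q => abs_apply_le w q)
  rwa [average_eq, smul_eq_mul, abs_mul, abs_inv, abs_of_pos hM, inv_mul_le_iff₀ hM, mul_comm]

/-- The operator `w ↦ b (Δw + n w - n ⨍ w)`. -/
def linearizedSpeed (n k : ℕ) (hk : 2 ≤ k) (b : ℝ) : CkSph n k →L[ℝ] C(Sph n, ℝ) :=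
  LinearMap.mkContinuous
    { toFun := fun w =>
        { toFun := fun p => b * (jacobi w p - n * ⨍ q, w q ∂surfaceMeasure n)
          continuous_toFun := continuous_const.mul
            ((continuous_jacobi (isC2_coe w hk)).sub continuous_const) }
      map_add' := fun v w => by
        ext p
        have h1 : ⨍ q, (v + w : CkSph n k) q ∂surfaceMeasure n
            = (⨍ q, v q ∂surfaceMeasure n) + ⨍ q, w q ∂surfaceMeasure n := by
          simp only [average_eq, ← smul_add]
          rw [← integral_add (integrable_of_continuous (continuous_coe v))
            (integrable_of_continuous (continuous_coe w))]
          rfl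
        change b * (jacobi (v + w : CkSph n k) p - _) = b * _ + b * _
        rw [h1, jacobi, jacobi, jacobi, sphLaplacian_add hk, ContMDiffMap.coe_add, Pi.add_apply]
        ring
      map_smul' := fun c w => by
        ext p
        have h1 : ⨍ q, (c • w : CkSph n k) q ∂surfaceMeasure n
            = c * ⨍ q, w q ∂surfaceMeasure n := by
          simp only [average_eq, smul_eq_mul]
          rw [mul_left_comm, ← integral_const_mul c]
          rfl
        change b * (jacobi (c • w : CkSph n k) p - _) = c * (b * _)
        rw [h1, jacobi, jacobi, sphLaplacian_smul hk, ContMDiffMap.coe_smul, Pi.smul_apply,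
          smul_eq_mul]
        ring }
    -- One `n` each for Δw, n w and n ⨍ w.
    (|b| * (3 * n)) fun w => by
      refine (ContinuousMap.norm_le _ (by positivity)).2 fun p => ?_
      have h1 : |sphLaplacian w p| ≤ n * ‖w‖ :=
        (abs_trace_le (finrank_tan p) _).trans
          (mul_le_mul_of_nonneg_left (norm_sphHess_le w hk p) (Nat.cast_nonneg n))
      have h2 := abs_apply_le w p
      have h3 := abs_average_le w
      change |b * (jacobi w p - _)| ≤ _
      rw [abs_mul, mul_assoc]
      refine mul_le_mul_of_nonneg_left ?_ (abs_nonneg b)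
      have hn : (0 : ℝ) ≤ n := Nat.cast_nonneg n
      rw [jacobi, abs_le] at *
      constructor <;> nlinarith

theorem linearizedSpeed_apply (hk : 2 ≤ k) (b : ℝ) (w : CkSph n k) (p : Sph n) :
    linearizedSpeed n k hk b w p = b * (jacobi w p - n * ⨍ q, w q ∂surfaceMeasure n) := rfl

theorem integral_jacobi {w : Sph n → ℝ} (hw : IsC2 w) :
    ∫ q, jacobi w q ∂surfaceMeasure n
      = (surfaceMeasure n).real Set.univ * (n * ⨍ q, w q ∂surfaceMeasure n) := by
  have hM := surfaceMeasure_real_pos (n := n)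
  simp only [jacobi]
  have hc : Continuous fun q => (n : ℝ) * w q := continuous_const.mul hw.continuous
  rw [integral_add (integrable_of_continuous (continuous_sphLaplacian hw))
    (integrable_of_continuous hc), integral_sphLaplacian hw,
    integral_const_mul, average_eq, smul_eq_mul]
  field_simp
  ring

end Average

/-! ### The linearisation of the speed -/

section Linearisation

open Asymptotics

variable {n k : ℕ} {θ : ℝ} {F : (Fin n → ℝ) → ℝ} {Ξ : CkSph n k → C(Sph n, ℝ)} {c : ℝ}

theorem tendsto_weight (hΞ : ContinuousAt Ξ 0) (hΞ0 : ∀ p, Ξ 0 p = c) :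
    Tendsto (fun z : CkSph n k × Sph n => Ξ z.1 z.2) (unifNhds n k) (𝓝 c) := by
  have h1 : Tendsto (fun z : CkSph n k × Sph n => ‖Ξ z.1 - Ξ 0‖) (unifNhds n k) (𝓝 0) := by
    have := ((hΞ.tendsto.sub_const (Ξ 0)).norm).comp (tendsto_fst_unifNhds (n := n) (k := k))
    rw [sub_self, norm_zero] at this
    exact this
  rw [← tendsto_sub_nhds_zero_iff]
  refine squeeze_zero_norm (fun z => ?_) h1
  have := (Ξ z.1 - Ξ 0).norm_coe_le_norm z.2
  rwa [ContinuousMap.sub_apply, hΞ0] at this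

theorem tendsto_weight_mul_density (hk : 2 ≤ k) (hθ : 0 < Real.sin θ) (hΞ : ContinuousAt Ξ 0)
    (hΞ0 : ∀ p, Ξ 0 p = c) :
    Tendsto (fun z : CkSph n k × Sph n => Ξ z.1 z.2 * density θ z.1 z.2) (unifNhds n k)
      (𝓝 (c * Real.sin θ ^ n)) :=
  (tendsto_weight hΞ hΞ0).mul (tendsto_density hk hθ)

theorem tendsto_integral_weight (hk : 2 ≤ k) (hθ : 0 < Real.sin θ) (hΞ : ContinuousAt Ξ 0)
    (hΞ0 : ∀ p, Ξ 0 p = c) :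
    Tendsto (fun u : CkSph n k => ∫ p, Ξ u p * density θ u p ∂surfaceMeasure n) (𝓝 0)
      (𝓝 (c * Real.sin θ ^ n * (surfaceMeasure n).real Set.univ)) := by
  have h1 := isLittleO_integral (h := fun _ => (1 : ℝ)) ((isLittleO_one_iff ℝ).2
    (tendsto_sub_nhds_zero_iff.2 (tendsto_weight_mul_density hk hθ hΞ hΞ0)))
  rw [← tendsto_sub_nhds_zero_iff]
  refine ((isLittleO_one_iff ℝ).1 h1).congr' ?_
  filter_upwards [eventually_sin_pos hθ] with u hu
  have hcont : Continuous fun p => Ξ u p * density θ u p :=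
    (Ξ u).continuous.mul (continuous_density (isC2_coe u hk) hu)
  rw [integral_sub (integrable_of_continuous hcont) (integrable_const _), integral_const, smul_eq_mul,
    mul_comm (Measure.real _ _)]

/-- Exact rearrangement of the error of the mean. Here `m` is weight times density, with limit `m₀`;
the first term integrates a small quantity, and the second has a factor tending to 0. -/
theorem weightedAverage_sub_eq {f m J : Sph n → ℝ} (hf : Continuous f) (hm : Continuous m)
    (hJ : Continuous J) (hI : ∫ p, m p ∂surfaceMeasure n ≠ 0) {f₀ m₀ b a M : ℝ}
    (hJi : ∫ p, J p ∂surfaceMeasure n = M * a) :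
    (∫ p, m p ∂surfaceMeasure n)⁻¹
        * (∫ p, ((f p - f₀) * m p + m₀ * b * J p) ∂surfaceMeasure n)
        + b * a * (1 - m₀ * M * (∫ p, m p ∂surfaceMeasure n)⁻¹)
      = (∫ p, f p * m p ∂surfaceMeasure n) / (∫ p, m p ∂surfaceMeasure n) - f₀ + b * a := by
  have h1 : Continuous fun p => f p * m p := hf.mul hm
  have h2 : Continuous fun p => f₀ * m p := continuous_const.mul hm
  have h3 : Continuous fun p => m₀ * b * J p := continuous_const.mul hJ
  have h4 : Continuous fun p => f p * m p - f₀ * m p := h1.sub h2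
  simp_rw [sub_mul]
  rw [integral_add (integrable_of_continuous h4) (integrable_of_continuous h3), integral_sub (integrable_of_continuous h1)
    (integrable_of_continuous h2), integral_const_mul, integral_const_mul, hJi]
  field_simp
  ring

theorem isLittleO_weightedAverage_aux (hk : 2 ≤ k) {f m : CkSph n k × Sph n → ℝ}
    {f₀ m₀ b M : ℝ} (hm₀ : m₀ * M ≠ 0)
    (hf : (fun z => f z - f₀ + b * jacobi z.1 z.2) =o[unifNhds n k] fun z => ‖z.1‖)
    (hm : Tendsto m (unifNhds n k) (𝓝 m₀))
    (hI : Tendsto (fun u => ∫ p, m (u, p) ∂surfaceMeasure n) (𝓝 0) (𝓝 (m₀ * M))) :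
    (fun u => (∫ p, m (u, p) ∂surfaceMeasure n)⁻¹
        * (∫ p, ((f (u, p) - f₀) * m (u, p) + m₀ * b * jacobi u p) ∂surfaceMeasure n)
        + b * (n * ⨍ q, u q ∂surfaceMeasure n)
          * (1 - m₀ * M * (∫ p, m (u, p) ∂surfaceMeasure n)⁻¹)) =o[𝓝 0] fun u => ‖u‖ := by
  have ha : (fun u : CkSph n k => n * ⨍ q, u q ∂surfaceMeasure n) =O[𝓝 0] fun u => ‖u‖ :=
    (IsBigO.of_bound 1 <| Eventually.of_forall fun u => by
      simpa using abs_average_le u).const_mul_left _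
  have h1 : (fun z => (f z - f₀) * m z + m₀ * b * jacobi z.1 z.2) =o[unifNhds n k]
      fun z => ‖z.1‖ := by
    -- The integrand equals (f − f₀ + bJ)m − bJ(m − m₀), with J = `jacobi`. As J is O(‖u‖), no rate
    -- is required of m → m₀.
    have h2 := hf.mul_isBigO (hm.isBigO_one ℝ)
    have h3 := ((isBigO_jacobi (n := n) hk).const_mul_left b).mul_isLittleO
      ((isLittleO_one_iff ℝ).2 (tendsto_sub_nhds_zero_iff.2 hm))
    simp_rw [mul_one] at h2 h3
    refine (h2.sub h3).congr_left fun z => ?_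
    ring
  have hIi := hI.inv₀ hm₀
  have h4 := (hIi.isBigO_one ℝ).mul_isLittleO (isLittleO_integral h1)
  have h5 : Tendsto (fun u => 1 - m₀ * M * (∫ p, m (u, p) ∂surfaceMeasure n)⁻¹) (𝓝 0)
      (𝓝 0) := by
    have := (hIi.const_mul (m₀ * M)).const_sub 1
    rwa [mul_inv_cancel₀ hm₀, sub_self] at this
  have h6 := (ha.const_mul_left b).mul_isLittleO ((isLittleO_one_iff ℝ).2 h5)
  simp_rw [one_mul] at h4
  simp_rw [mul_one] at h6
  exact h4.add h6

theorem isLittleO_weightedAverage [NeZero n] (hk : 2 ≤ k) (hθ : 0 < Real.sin θ)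
    (hF : ContDiff ℝ ∞ F)
    (hFsymm : ∀ (σ : Equiv.Perm (Fin n)) (x : Fin n → ℝ), F (x ∘ σ) = F x)
    (hΞ : ContinuousAt Ξ 0) (hc : c ≠ 0) (hΞ0 : ∀ p, Ξ 0 p = c) :
    (fun u : CkSph n k => (∫ p, F (principalCurvatures θ u p) * Ξ u p ∂graphMeasure θ u)
        / (∫ p, Ξ u p ∂graphMeasure θ u) - F (fun _ => Real.cot θ)
      + fderiv ℝ F (fun _ => Real.cot θ) (Pi.single 0 1) * (Real.sin θ ^ 2)⁻¹
        * (n * ⨍ q, u q ∂surfaceMeasure n)) =o[𝓝 0] fun u => ‖u‖ := by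
  have hm₀ : c * Real.sin θ ^ n * (surfaceMeasure n).real Set.univ ≠ 0 :=
    mul_ne_zero (mul_ne_zero hc (pow_ne_zero n hθ.ne')) surfaceMeasure_real_pos.ne'
  have hI := tendsto_integral_weight hk hθ hΞ hΞ0
  have h := isLittleO_weightedAverage_aux hk hm₀
    (isLittleO_speedFunction hk hθ (hF.differentiable (by simp) _) hFsymm)
    (tendsto_weight_mul_density hk hθ hΞ hΞ0) hI
  refine h.congr' ?_ EventuallyEq.rfl
  have hev := (eventually_sin_pos (n := n) (k := k) hθ).and (hI.eventually_ne hm₀)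
  refine hev.mono fun u hu => ?_
  have hu2 := isC2_coe u hk
  have h1 := weightedAverage_sub_eq (f₀ := F fun _ => Real.cot θ) (m₀ := c * Real.sin θ ^ n)
    (b := fderiv ℝ F (fun _ => Real.cot θ) (Pi.single 0 1) * (Real.sin θ ^ 2)⁻¹)
    (hF.continuous.comp (continuous_principalCurvatures hu2 hu.1))
    ((Ξ u).continuous.mul (continuous_density hu2 hu.1)) (continuous_jacobi hu2) hu.2
    (integral_jacobi hu2)
  beta_reduce
  rw [integral_graphMeasure hu2 hu.1, integral_graphMeasure hu2 hu.1]
  simp only [Function.comp_apply, Pi.mul_apply, mul_assoc] at h1 ⊢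
  exact h1

theorem graphSpeed_eq {u : CkSph n k} (hk : 2 ≤ k) (hs : ∀ q, 0 < Real.sin (θ + u q))
    (p : Sph n) (Ξ₀ : Sph n → ℝ) :
    graphSpeed θ u p F Ξ₀ = slope θ u p *
      ((∫ q, F (principalCurvatures θ u q) * Ξ₀ q ∂graphMeasure θ u)
        / (∫ q, Ξ₀ q ∂graphMeasure θ u) - F (principalCurvatures θ u p)) := by
  rw [graphSpeed, tilt_eq (isC2_coe u hk) (hs p), speedHat]

/-- The error is W times the difference of the errors of the mean and of F(κ), plus (W − 1)·b(Δu +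
nu − n⨍u); the last product is o(‖u‖) since W → 1. -/
theorem isLittleO_graphSpeed [NeZero n] (hk : 2 ≤ k) (hθ : 0 < Real.sin θ)
    (hF : ContDiff ℝ ∞ F)
    (hFsymm : ∀ (σ : Equiv.Perm (Fin n)) (x : Fin n → ℝ), F (x ∘ σ) = F x)
    (hΞ : ContinuousAt Ξ 0) (hc : c ≠ 0) (hΞ0 : ∀ p, Ξ 0 p = c) :
    (fun z : CkSph n k × Sph n => graphSpeed θ z.1 z.2 F (Ξ z.1)
      - linearizedSpeed n k hk (fderiv ℝ F (fun _ => Real.cot θ) (Pi.single 0 1)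
        * (Real.sin θ ^ 2)⁻¹) z.1 z.2) =o[unifNhds n k] fun z => ‖z.1‖ := by
  have h1 := (isLittleO_weightedAverage hk hθ hF hFsymm hΞ hc hΞ0).comp_tendsto
    (tendsto_fst_unifNhds (n := n) (k := k))
  have h2 := isLittleO_speedFunction (k := k) hk hθ (hF.differentiable (by simp) _) hFsymm
  set b := fderiv ℝ F (fun _ => Real.cot θ) (Pi.single 0 1) * (Real.sin θ ^ 2)⁻¹
  have h3 := ((tendsto_slope (n := n) hk hθ).isBigO_one ℝ).mul_isLittleO (h1.sub h2)
  have ha : (fun z : CkSph n k × Sph n => n * ⨍ q, z.1 q ∂surfaceMeasure n) =O[unifNhds n k]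
      fun z => ‖z.1‖ :=
    (IsBigO.of_bound 1 <| Eventually.of_forall fun z => by
      simpa using abs_average_le z.1).const_mul_left _
  have h4 := ((isLittleO_one_iff ℝ).2 (tendsto_sub_nhds_zero_iff.2
    (tendsto_slope (n := n) hk hθ))).mul_isBigO
      (((isBigO_jacobi (n := n) hk).sub ha).const_mul_left b)
  simp_rw [one_mul] at h3 h4
  refine (h3.add h4).congr' ?_ EventuallyEq.rfl
  filter_upwards [tendsto_fst_unifNhds.eventually (eventually_sin_pos hθ)] with z hz
  rw [graphSpeed_eq hk hz, linearizedSpeed_apply]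
  simp only [Function.comp_apply]
  ring

theorem continuous_graphSpeed {u : CkSph n k} (hk : 2 ≤ k) (hs : ∀ q, 0 < Real.sin (θ + u q))
    (hF : Continuous F) (Ξ₀ : Sph n → ℝ) : Continuous fun p => graphSpeed θ u p F Ξ₀ := by
  simp_rw [graphSpeed_eq hk hs]
  exact (continuous_slope (isC2_coe u hk) hs).mul (continuous_const.sub
    (hF.comp (continuous_principalCurvatures (isC2_coe u hk) hs)))

/-- At u = 0 the density is the constant sinⁿθ, which cancels in an average. -/
theorem average_graphMeasure_zero (hk : 2 ≤ k) (hθ : 0 < Real.sin θ) (w : Sph n → ℝ) :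
    ⨍ q, w q ∂graphMeasure θ (0 : Sph n → ℝ) = ⨍ q, w q ∂surfaceMeasure n := by
  have h0 : IsC2 (0 : Sph n → ℝ) := isC2_coe (0 : CkSph n k) hk
  have hs : ∀ q : Sph n, 0 < Real.sin (θ + (0 : Sph n → ℝ) q) := fun q => by simpa using hθ
  have hd : ∀ q : Sph n, density θ (0 : Sph n → ℝ) q = Real.sin θ ^ n := fun q => by
    have h1 : ‖sphGrad (0 : Sph n → ℝ) q‖ = 0 :=
      le_antisymm ((norm_sphGrad_le (0 : CkSph n k) hk q).trans_eq norm_zero) (norm_nonneg _)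
    simp [density, slope, h1]
  have h2 : graphMeasure θ (0 : Sph n → ℝ)
      = ENNReal.ofReal (Real.sin θ ^ n) • surfaceMeasure n := by
    rw [graphMeasure_eq h0 hs]
    simp_rw [hd]
    rw [withDensity_const]
  have h3 : 0 < Real.sin θ ^ n := pow_pos hθ n
  rw [h2, average_eq, average_eq, integral_smul_measure, measureReal_ennreal_smul_apply,
    ENNReal.toReal_ofReal h3.le, smul_eq_mul, smul_eq_mul, smul_eq_mul, mul_inv]
  field_simp

end Linearisation

end SphereFlow

end

/-! ### The linearisation theorem -/

theorem mainTheorem6 (n : ℕ) [NeZero n] (k : ℕ) (hk : 2 ≤ k)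
    (θ : ℝ) (hθ : θ ∈ Set.Ioo 0 Real.pi)
    (F : (Fin n → ℝ) → ℝ) (hF : ContDiff ℝ ∞ F)
    (hFsymm : ∀ (σ : Equiv.Perm (Fin n)) (x : Fin n → ℝ), F (x ∘ σ) = F x)
    -- `Ξ u` is the weight function on the hypersurface `X_u`
    (Ξ : SphereFlow.CkSph n k → C(SphereFlow.Sph n, ℝ)) (hΞ : ContinuousAt Ξ 0)
    (c : ℝ) (hc : c ≠ 0) (hΞ0 : ∀ p, Ξ 0 p = c) :
    -- all principal curvatures of the base sphere equal `cot θ`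
    (∀ p : SphereFlow.Sph n,
      SphereFlow.principalCurvatures θ (0 : SphereFlow.Sph n → ℝ) p = fun _ => Real.cot θ) ∧
    ∃ G : SphereFlow.CkSph n k → C(SphereFlow.Sph n, ℝ),
      -- near `0`, `G` is the (well defined) speed of the graph function
      (∀ᶠ u : SphereFlow.CkSph n k in 𝓝 (0 : SphereFlow.CkSph n k),
        Integrable (fun p => F (SphereFlow.principalCurvatures θ u p) * Ξ u p)
          (SphereFlow.graphMeasure θ u) ∧
        Integrable (fun p => Ξ u p) (SphereFlow.graphMeasure θ u) ∧
        ∫ p, Ξ u p ∂SphereFlow.graphMeasure θ u ≠ 0 ∧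
        ∀ p, G u p = SphereFlow.graphSpeed θ u p F (Ξ u)) ∧
      -- and its Fréchet derivative at `0` is the stated operator
      ∃ A : SphereFlow.CkSph n k →L[ℝ] C(SphereFlow.Sph n, ℝ),
        HasFDerivAt G A 0 ∧
        ∀ (w : SphereFlow.CkSph n k) (p : SphereFlow.Sph n),
          A w p = fderiv ℝ F (fun _ => Real.cot θ) (Pi.single 0 1) * (Real.sin θ ^ 2)⁻¹ *
            (SphereFlow.sphLaplacian w p + n * w p
              - n * ⨍ q, w q ∂SphereFlow.graphMeasure θ (0 : SphereFlow.Sph n → ℝ)) := by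
  classical
  have hs : 0 < Real.sin θ := Real.sin_pos_of_pos_of_lt_pi hθ.1 hθ.2
  refine ⟨SphereFlow.principalCurvatures_zero hs, ?_⟩
  let G : SphereFlow.CkSph n k → C(SphereFlow.Sph n, ℝ) := fun u =>
    if h : Continuous fun p => SphereFlow.graphSpeed θ u p F (Ξ u) then ⟨_, h⟩ else 0
  have hG : ∀ᶠ u : SphereFlow.CkSph n k in 𝓝 0,
      ∀ p, G u p = SphereFlow.graphSpeed θ u p F (Ξ u) := by
    filter_upwards [SphereFlow.eventually_sin_pos hs] with u hu p
    simp only [G]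
    rw [dif_pos (SphereFlow.continuous_graphSpeed hk hu hF.continuous (Ξ u))]
    rfl
  refine ⟨G, ?_, SphereFlow.linearizedSpeed n k hk
    (fderiv ℝ F (fun _ => Real.cot θ) (Pi.single 0 1) * (Real.sin θ ^ 2)⁻¹), ?_, fun w p => ?_⟩
  · have hne : c * Real.sin θ ^ n * (SphereFlow.surfaceMeasure n).real Set.univ ≠ 0 :=
      mul_ne_zero (mul_ne_zero hc (pow_ne_zero n hs.ne')) SphereFlow.surfaceMeasure_real_pos.ne'
    filter_upwards [hG, SphereFlow.eventually_sin_pos hs,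
      (SphereFlow.tendsto_integral_weight hk hs hΞ hΞ0).eventually_ne hne] with u hGu hu hIu
    have hu2 := SphereFlow.isC2_coe u hk
    have := SphereFlow.isFiniteMeasure_graphMeasure hu2 hu
    refine ⟨SphereFlow.integrable_of_continuous ((hF.continuous.comp
      (SphereFlow.continuous_principalCurvatures hu2 hu)).mul (Ξ u).continuous),
      SphereFlow.integrable_of_continuous (Ξ u).continuous, ?_, hGu⟩
    rwa [SphereFlow.integral_graphMeasure hu2 hu]
  · have h1 := SphereFlow.isLittleO_graphSpeed hk hs hF hFsymm hΞ hc hΞ0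
    have h2 : ∀ ε : ℝ, 0 < ε → ∀ᶠ u : SphereFlow.CkSph n k in 𝓝 0,
        ‖G u - SphereFlow.linearizedSpeed n k hk
          (fderiv ℝ F (fun _ => Real.cot θ) (Pi.single 0 1) * (Real.sin θ ^ 2)⁻¹) u‖
          ≤ ε * ‖u‖ := fun ε hε => by
      filter_upwards [hG, SphereFlow.eventually_unifNhds.1 (Asymptotics.isLittleO_iff.1 h1 hε)]
        with u hGu hu
      refine (ContinuousMap.norm_le _ (by positivity)).2 fun p => ?_
      have := hu p
      rwa [norm_norm, ← hGu p] at this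
    -- The estimate `h2` evaluated at u = 0 reads ‖G 0‖ ≤ 0.
    have h3 : G 0 = 0 := by
      have := (h2 1 one_pos).self_of_nhds
      rwa [map_zero, sub_zero, norm_zero, mul_zero, norm_le_zero_iff] at this
    rw [hasFDerivAt_iff_isLittleO_nhds_zero, Asymptotics.isLittleO_iff]
    intro ε hε
    filter_upwards [h2 ε hε] with u hu
    rwa [zero_add, h3, sub_zero]
  · rw [SphereFlow.linearizedSpeed_apply, SphereFlow.average_graphMeasure_zero hk hs w,
      SphereFlow.jacobi]
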